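/- Let $1<p<\infty$, $0<\beta<1$ and $0<Q<\infty$ be such that $Q>\beta p$. Let $(X,d)$ be a complete and connected metric space equipped with a (completed) Borel measure $\mu$ such that $0<\mu(B)<\infty$ for every ball $B(x,r)=\{y\in X: d(y,x)<r\}$, $r>0$. Assume that $\mu$ is Ahlfors $Q$-regular, that is, there is $c\ge 1$ such that $c^{-1}r^Q\le \mu(B(x,r))\le c\,r^Q$ for all $x\in X$ and all $0<r<\operatorname{diam}(X)\in[0,\infty]$. Write $\overline{B}(x,r)=\{y\in X: d(y,x)\le r\}$. For a nonnegative measurable function $f$ on $X$ put \[ I_\beta f(x)=\int_X \frac{f(y)\,d(x,y)^\beta}{\mu(B(x,d(x,y)))}\,d\mu(y),\qquad \mathcal I_\beta f(x)=\int_X \frac{f(y)}{d(x,y)^{Q-\beta}}\,d\mu(y),\qquad x\in X, \] and for $F\subset X$ define the Riesz $(\beta,p)$-capacity $R_{\beta,p}(F)=\inf\{\int_X f^p\,d\mu : f\ge 0 \text{ measurable},\ I_\beta f\ge 1\text{ on }F\}$, and $\mathcal R_{\beta,p}(F)$ in the same way with $\mathcal I_\beta f$ in place of $I_\beta f$. For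 a bounded open set $\Omega\subset X$ and a closed set $F\subset X$ with $F\subset\Omega$, the relative Hajłasz $(\beta,p)$-capacity is \[ \operatorname{cap}_{\beta,p}(F,\Omega)=\inf_u\inf_g\int_X g^p\,d\mu , \] where the infima are over all $\beta$-Hölder functions $u:X\to\mathbb R$ with $u\ge 1$ on $F$ and $u=0$ on $X\setminus\Omega$, and over all measurable $g:X\to[0,\infty]$ for which there is a set $N$ with $\mu(N)=0$ and $|u(x)-u(y)|\le d(x,y)^\beta(g(x)+g(y))$ for all $x,y\in X\setminus N$ (infima over the empty set are $\infty$). Then there is a constant $C>0$ such that \[ C^{-1}R_{\beta,p}(E\cap\overline{B}(x,r))\le \operatorname{cap}_{\beta,p}\big(E\cap\overline{B}(x,r),B(x,2r)\big)\le C\,R_{\beta,p}(E\cap\overline{B}(x,r)) \] whenever $E\subset X$ is closed, $x\in E$ and $0<r<\tfrac18\operatorname{diam}(X)$. The same estimates hold, for the same $E$, $x$, $r$, with $\mathcal R_{\beta,p}$ in place of $R_{\beta,p}$. -/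

import Mathlib

open scoped ENNReal

noncomputable section

namespace MetricCapacity

open MeasureTheory

variable {X : Type*} [MetricSpace X] [MeasurableSpace X]

/-- `μ` is Ahlfors `Q`-regular: `c⁻¹ r ^ Q ≤ μ (B(x, r)) ≤ c r ^ Q` for some `c ≥ 1`, all `x`
and all `0 < r < diam X`, where `diam X ∈ [0, ∞]`. -/
def IsAhlforsRegular (μ : Measure X) (Q : ℝ) : Prop :=
  ∃ c : ℝ, 1 ≤ c ∧ ∀ (x : X) (r : ℝ), 0 < r →
    ENNReal.ofReal r < Metric.ediam (Set.univ : Set X) →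
      ENNReal.ofReal (c⁻¹ * r ^ Q) ≤ μ (Metric.ball x r) ∧
        μ (Metric.ball x r) ≤ ENNReal.ofReal (c * r ^ Q)

/-- `u ∈ Lip_β(X)`: the real function `u` is `β`-Hölder on all of `X`. -/
def IsHolderFun (β : ℝ) (u : X → ℝ) : Prop :=
  ∃ κ : ℝ, 0 ≤ κ ∧ ∀ x y : X, |u x - u y| ≤ κ * dist x y ^ β

/-- `g : X → [0, ∞]` is a Hajłasz `β`-gradient of `u`. Measurability refers to the completion of
the measure `μ`, that is, to `AEMeasurable`. -/
def IsHajlaszGradient (μ : Measure X) (β : ℝ) (u : X → ℝ) (g : X → ℝ≥0∞) : Prop :=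
  AEMeasurable g μ ∧ ∃ N : Set X, μ N = 0 ∧ ∀ x y : X, x ∉ N → y ∉ N →
    ENNReal.ofReal |u x - u y| ≤ ENNReal.ofReal (dist x y ^ β) * (g x + g y)

/-- The variational Hajłasz `(β, p)`-capacity of `F` relative to `Ω`; it is `∞` if there is no
admissible `u`. -/
def hajlaszCapacity (μ : Measure X) (β p : ℝ) (F Ω : Set X) : ℝ≥0∞ :=
  ⨅ (u : X → ℝ) (_ : IsHolderFun β u) (_ : ∀ x ∈ F, 1 ≤ u x) (_ : ∀ x ∉ Ω, u x = 0)
    (g : X → ℝ≥0∞) (_ : IsHajlaszGradient μ β u g), ∫⁻ x, g x ^ p ∂μ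

/-- The Riesz potential `I_β f (x) = ∫ f(y) d(x,y) ^ β / μ (B(x, d(x,y))) dμ(y)`. -/
def rieszPotential (μ : Measure X) (β : ℝ) (f : X → ℝ≥0∞) (x : X) : ℝ≥0∞ :=
  ∫⁻ y, f y * ENNReal.ofReal (dist x y ^ β) / μ (Metric.ball x (dist x y)) ∂μ

/-- The Riesz `(β, p)`-capacity: the infimum of `‖f‖_p ^ p` over nonnegative measurable `f`
with `I_β f ≥ 1` on `F`. -/
def rieszCapacity (μ : Measure X) (β p : ℝ) (F : Set X) : ℝ≥0∞ :=
  ⨅ (f : X → ℝ≥0∞) (_ : AEMeasurable f μ) (_ : ∀ x ∈ F, 1 ≤ rieszPotential μ β f x),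
    ∫⁻ x, f x ^ p ∂μ

/-- The variant `∫ f(y) / d(x,y) ^ (Q - β) dμ(y)` of the Riesz potential. -/
def rieszPotentialOfDim (μ : Measure X) (Q β : ℝ) (f : X → ℝ≥0∞) (x : X) : ℝ≥0∞ :=
  ∫⁻ y, f y / ENNReal.ofReal (dist x y ^ (Q - β)) ∂μ

/-- The Riesz `(β, p)`-capacity formed with the potential `∫ f(y) / d(x,y) ^ (Q - β) dμ(y)`. -/
def rieszCapacityOfDim (μ : Measure X) (Q β p : ℝ) (F : Set X) : ℝ≥0∞ :=
  ⨅ (f : X → ℝ≥0∞) (_ : AEMeasurable f μ) (_ : ∀ x ∈ F, 1 ≤ rieszPotentialOfDim μ Q β f x),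
    ∫⁻ x, f x ^ p ∂μ

end MetricCapacity

end

/-! Ahlfors regularity makes `μ (B(x, d(x,y)))` comparable to `d(x,y) ^ Q`, and points are null, so
the two Riesz potentials, hence the two Riesz capacities, are comparable. It remains to compare the
capacity of the kernel `d ^ (β - Q)` with the Hajłasz capacity.

Riesz below Hajłasz: let `u`, `g` be admissible for the Hajłasz capacity. By connectedness there is
a ball `B(z, r)` outside `B(x, 2r)`, on which `u = 0`. Starting there, a chain of points in dyadic
balls shrinking to `y`, at each of which `g` is at most its mean, bounds `u y` by a sum of terms `t
^ (β - Q) ∫_{B(y,t)} g`. That sum is at most a constant times the potential of `g` at `y`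
(`exists_ofReal_le_rieszPotentialOfDim`), so a multiple of `g` competes for the Riesz capacity.

Hajłasz below Riesz: let `f` be admissible for the Riesz capacity, with potential `P` and maximal
function `M`. Splitting the integral at `d(x,y)` gives `|P x - P y| ≤ C d(x,y) ^ β (M x + M y)`
(from `exists_rieszPotentialOfDim_le_add`). Cutting `P` off in `B(x, 2r)` adds `r ^ (-β) P` to the
gradient, and a Hedberg splitting at scale `r` bounds this by `M` plus `r ^ (-Q/p) ‖f‖_p`
(`exists_rieszPotentialOfDim_le`). The `L ^ p` maximal inequality and the mass of `B(x, 2r)` then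
give the energy bound. For the cut-off potential to be Hölder, `f` is first truncated; the
potentials of the truncations increase to `P`, and compactness of the set, from properness of `X`,
makes one truncation suffice. -/

noncomputable section

namespace MetricCapacity

open MeasureTheory

/-! ### Mass bounds and properness -/

section Geometry

open Metric Set Filter Topology

variable {X : Type*} [MetricSpace X] [MeasurableSpace X]

/-- In an Ahlfors regular space the upper mass bound holds for balls of every radius, after
enlarging the constant. -/
theorem IsAhlforsRegular.exists_measure_ball_le [Nontrivial X] {μ : Measure X} {Q : ℝ}
    (hQ : 0 < Q) (hreg : IsAhlforsRegular μ Q)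
    (hfin : ∀ (x : X) (r : ℝ), 0 < r → μ (ball x r) < ∞) :
    ∃ c : ℝ, 1 ≤ c ∧ ∀ (x : X) (t : ℝ), 0 < t → μ (ball x t) ≤ ENNReal.ofReal (c * t ^ Q) := by
  obtain ⟨c, hc, h⟩ := hreg
  by_cases hD : ediam (univ : Set X) = ∞
  · exact ⟨c, hc, fun x t ht => (h x t ht (by simp [hD])).2⟩
  obtain ⟨x₀, x₁, hne⟩ := exists_pair_ne X
  set D := (ediam (univ : Set X)).toReal with hDdef
  have hdist : ∀ x y : X, dist x y ≤ D := fun x y => by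
    rw [dist_edist]
    exact ENNReal.toReal_mono hD (edist_le_ediam_of_mem (mem_univ x) (mem_univ y))
  have hDpos : 0 < D := (dist_pos.2 hne).trans_le (hdist _ _)
  have huniv : μ univ < ∞ := by
    refine lt_of_le_of_lt (measure_mono fun y _ => ?_) (hfin x₀ (D + 1) (by linarith))
    rw [mem_ball]
    linarith [hdist y x₀]
  set m := (μ univ).toReal
  have hm : 0 ≤ m := ENNReal.toReal_nonneg
  have hDQ : 0 < D ^ Q := Real.rpow_pos_of_pos hDpos Q
  refine ⟨c + m / D ^ Q, by have := div_nonneg hm hDQ.le; linarith, fun x t ht => ?_⟩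
  have htQ : 0 < t ^ Q := Real.rpow_pos_of_pos ht Q
  rcases lt_or_ge t D with htD | htD
  · refine (h x t ht ?_).2.trans (ENNReal.ofReal_le_ofReal ?_)
    · rw [← ENNReal.ofReal_toReal hD]
      exact (ENNReal.ofReal_lt_ofReal_iff hDpos).2 htD
    · have := div_nonneg hm hDQ.le
      nlinarith
  -- Beyond the diameter the ball has at most the total mass `m`, finite because `X` is bounded
  -- here; this is the source of the term `m / D ^ Q`.
  · calc μ (ball x t) ≤ μ univ := measure_mono (subset_univ _)
      _ = ENNReal.ofReal m := (ENNReal.ofReal_toReal huniv.ne).symm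
      _ ≤ _ := by
        refine ENNReal.ofReal_le_ofReal ?_
        have h1 : m = m / D ^ Q * D ^ Q := by field_simp
        have h2 : D ^ Q ≤ t ^ Q := Real.rpow_le_rpow hDpos.le htD hQ.le
        have h3 := mul_le_mul_of_nonneg_left h2 (div_nonneg hm hDQ.le)
        nlinarith

/-- A power upper bound for the mass of balls excludes atoms. -/
theorem measure_singleton_of_measure_ball_le {μ : Measure X} {c Q : ℝ} (hQ : 0 < Q)
    (hup : ∀ (x : X) (t : ℝ), 0 < t → μ (ball x t) ≤ ENNReal.ofReal (c * t ^ Q)) (x : X) :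
    μ {x} = 0 := by
  have hlim : Tendsto (fun t : ℝ => ENNReal.ofReal (c * t ^ Q)) (𝓝[>] 0) (𝓝 0) := by
    have h1 : Tendsto (fun t : ℝ => ENNReal.ofReal (c * t ^ Q)) (𝓝 0)
        (𝓝 (ENNReal.ofReal (c * 0 ^ Q))) :=
      (ENNReal.continuous_ofReal.tendsto _).comp
        ((Real.continuousAt_rpow_const 0 Q (Or.inr hQ.le)).tendsto.const_mul c)
    rw [Real.zero_rpow hQ.ne', mul_zero, ENNReal.ofReal_zero] at h1
    exact h1.mono_left nhdsWithin_le_nhds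
  refine le_antisymm (ge_of_tendsto hlim ?_) zero_le
  filter_upwards [self_mem_nhdsWithin] with t ht
  exact (measure_mono (singleton_subset_iff.2 (mem_ball_self ht))).trans (hup x t ht)

/-- A complete space with a uniform lower bound for the mass of balls of each small radius, and
finite mass on balls, is proper. -/
theorem properSpace_of_le_measure_ball [CompleteSpace X] [BorelSpace X] {μ : Measure X}
    (hfin : ∀ (x : X) (r : ℝ), 0 < r → μ (ball x r) < ∞)
    (hlow : ∀ ε : ℝ, 0 < ε → ∃ t : ℝ, 0 < t ∧ t ≤ ε ∧ ∃ m : ℝ≥0∞, 0 < m ∧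
      ∀ x : X, m ≤ μ (ball x t)) : ProperSpace X := by
  refine ProperSpace.of_isCompact_closedBall_of_le 0 fun x R hR => ?_
  refine TotallyBounded.isCompact_of_isClosed ?_ isClosed_closedBall
  refine Metric.totallyBounded_iff.2 fun ε hε => ?_
  -- Disjoint balls of radius `t` centred in the bounded ball each have mass at least `m`, so they
  -- are finitely many. Their enlargements by the factor 4 cover, and `4 t < ε`.
  obtain ⟨t, ht, htε, m, hm, hmle⟩ := hlow (ε / 5) (by positivity)
  obtain ⟨u, hu, hdisj, hcov⟩ := Vitali.exists_disjoint_subfamily_covering_enlargement_closedBall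
    (closedBall x R) id (fun _ => t) t (fun _ _ => le_rfl) 4 (by norm_num)
  refine ⟨u, ?_, ?_⟩
  · have hfinite := Measure.finite_const_le_meas_of_disjoint_iUnion (ι := u) μ hm
      (As := fun i => closedBall (i : X) t) (fun i => isClosed_closedBall.measurableSet)
      (fun i j hij => hdisj i.2 j.2 (fun h => hij (Subtype.ext h)))
      (by
        refine ((measure_mono ?_).trans_lt (hfin x (R + t + 1) (by linarith))).ne
        refine iUnion_subset fun i y hy => ?_
        have h1 := mem_closedBall.1 (hu i.2)
        have h2 : dist y i ≤ t := hy
        rw [mem_ball]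
        have h3 := dist_triangle y i x
        linarith)
    have hall : {i : u | m ≤ μ (closedBall (i : X) t)} = univ :=
      eq_univ_of_forall fun i => (hmle i).trans (measure_mono ball_subset_closedBall)
    rw [hall] at hfinite
    exact finite_univ_iff.1 hfinite
  · intro y hy
    obtain ⟨b, hb, hsub⟩ := hcov y hy
    refine mem_iUnion₂.2 ⟨b, hb, ?_⟩
    have : dist y b ≤ 4 * t := hsub (mem_closedBall_self ht.le)
    rw [mem_ball]
    linarith

end Geometry

/-! ### The maximal function: weak type and `L ^ p` bounds -/

section MaximalFunction

open Metric Set Filter Topology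

variable {X : Type*} [MetricSpace X] [MeasurableSpace X]

/-- The maximal function of dimension `Q`, `sup_{t > 0} t ^ (-Q) ∫_{B(x, t)} f dμ`. -/
def maximalFunction (μ : Measure X) (Q : ℝ) (f : X → ℝ≥0∞) (x : X) : ℝ≥0∞ :=
  ⨆ (t : ℝ) (_ : 0 < t), (∫⁻ z in ball x t, f z ∂μ) / ENNReal.ofReal (t ^ Q)

theorem setLIntegral_ball_le_maximalFunction {μ : Measure X} {Q : ℝ} (f : X → ℝ≥0∞) (x : X)
    {t : ℝ} (ht : 0 < t) :
    ∫⁻ z in ball x t, f z ∂μ ≤ maximalFunction μ Q f x * ENNReal.ofReal (t ^ Q) := by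
  have h : ENNReal.ofReal (t ^ Q) ≠ 0 := by simp [Real.rpow_pos_of_pos ht]
  rw [← ENNReal.div_le_iff h ENNReal.ofReal_ne_top]
  exact le_iSup₂ (f := fun (t : ℝ) (_ : 0 < t) =>
    (∫⁻ z in ball x t, f z ∂μ) / ENNReal.ofReal (t ^ Q)) t ht

theorem lt_maximalFunction_iff {μ : Measure X} {Q : ℝ} {f : X → ℝ≥0∞} {x : X} {a : ℝ≥0∞} :
    a < maximalFunction μ Q f x ↔
      ∃ t : ℝ, 0 < t ∧ a * ENNReal.ofReal (t ^ Q) < ∫⁻ z in ball x t, f z ∂μ := by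
  unfold maximalFunction
  simp only [lt_iSup_iff, exists_prop]
  refine exists_congr fun t => and_congr_right fun ht => ?_
  rw [ENNReal.lt_div_iff_mul_lt (Or.inl (by simp [Real.rpow_pos_of_pos ht]))
    (Or.inl ENNReal.ofReal_ne_top)]

/-- Continuity from below: an open ball is the increasing union of smaller concentric balls. The
room `t - s` gained lets the centre move, which gives semicontinuity of the maximal function. -/
theorem exists_lt_measure_ball_of_lt {ν : Measure X} {x : X} {t : ℝ} (ht : 0 < t) {a : ℝ≥0∞}
    (h : a < ν (ball x t)) : ∃ s : ℝ, 0 < s ∧ s < t ∧ a < ν (ball x s) := by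
  obtain ⟨u, hu, hut, hlim⟩ := exists_seq_strictMono_tendsto' ht
  have hU : ball x t = ⋃ n, ball x (u n) := by
    ext y
    simp only [mem_ball, mem_iUnion]
    refine ⟨fun hy => ?_, fun ⟨n, hn⟩ => hn.trans (hut n).2⟩
    exact ((tendsto_order.1 hlim).1 _ hy).exists
  have hmono : Monotone fun n => ball x (u n) := fun m n hmn => ball_subset_ball (hu.monotone hmn)
  rw [hU, hmono.measure_iUnion, lt_iSup_iff] at h
  obtain ⟨n, hn⟩ := h
  exact ⟨u n, (hut n).1, (hut n).2, hn⟩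

theorem lowerSemicontinuous_maximalFunction [OpensMeasurableSpace X] (μ : Measure X) (Q : ℝ)
    (f : X → ℝ≥0∞) : LowerSemicontinuous (maximalFunction μ Q f) := by
  rw [lowerSemicontinuous_iff_isOpen_preimage]
  intro a
  rw [Metric.isOpen_iff]
  intro x hx
  obtain ⟨t, ht, hlt⟩ := lt_maximalFunction_iff.1 (mem_Ioi.1 hx)
  rw [← withDensity_apply _ measurableSet_ball] at hlt
  obtain ⟨s, hs, hst, hlt⟩ := exists_lt_measure_ball_of_lt ht hlt
  rw [withDensity_apply _ measurableSet_ball] at hlt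
  refine ⟨t - s, by linarith, fun y hy => ?_⟩
  refine lt_maximalFunction_iff.2 ⟨t, ht, hlt.trans_le (lintegral_mono_set ?_)⟩
  refine ball_subset_ball' ?_
  rw [mem_ball, dist_comm] at hy
  linarith

theorem measurable_maximalFunction [OpensMeasurableSpace X] (μ : Measure X) (Q : ℝ)
    (f : X → ℝ≥0∞) : Measurable (maximalFunction μ Q f) :=
  (lowerSemicontinuous_maximalFunction μ Q f).measurable

theorem maximalFunction_add_le {μ : Measure X} {Q : ℝ} {f : X → ℝ≥0∞} (hf : Measurable f)
    (g : X → ℝ≥0∞) (x : X) :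
    maximalFunction μ Q (fun z => f z + g z) x ≤
      maximalFunction μ Q f x + maximalFunction μ Q g x := by
  refine iSup₂_le fun t ht => ?_
  rw [lintegral_add_left hf, ENNReal.add_div]
  exact add_le_add
    (le_iSup₂ (f := fun (t : ℝ) (_ : 0 < t) =>
      (∫⁻ z in ball x t, f z ∂μ) / ENNReal.ofReal (t ^ Q)) t ht)
    (le_iSup₂ (f := fun (t : ℝ) (_ : 0 < t) =>
      (∫⁻ z in ball x t, g z ∂μ) / ENNReal.ofReal (t ^ Q)) t ht)

theorem maximalFunction_mono {μ : Measure X} {Q : ℝ} {f g : X → ℝ≥0∞} (h : ∀ x, f x ≤ g x)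
    (x : X) : maximalFunction μ Q f x ≤ maximalFunction μ Q g x :=
  iSup₂_mono fun _ _ => ENNReal.div_le_div_right (lintegral_mono h) _

theorem maximalFunction_le_of_le {μ : Measure X} {c Q : ℝ} (hc : 0 ≤ c)
    (hup : ∀ (x : X) (t : ℝ), 0 < t → μ (ball x t) ≤ ENNReal.ofReal (c * t ^ Q))
    {f : X → ℝ≥0∞} {K : ℝ≥0∞} (hK : ∀ x, f x ≤ K) (x : X) :
    maximalFunction μ Q f x ≤ K * ENNReal.ofReal c := by
  refine iSup₂_le fun t ht => ?_
  have h : ENNReal.ofReal (t ^ Q) ≠ 0 := by simp [Real.rpow_pos_of_pos ht]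
  rw [ENNReal.div_le_iff h ENNReal.ofReal_ne_top]
  calc ∫⁻ z in ball x t, f z ∂μ ≤ ∫⁻ _ in ball x t, K ∂μ := lintegral_mono hK
    _ = K * μ (ball x t) := by rw [setLIntegral_const]
    _ ≤ K * ENNReal.ofReal (c * t ^ Q) := by gcongr; exact hup x t ht
    _ = _ := by rw [ENNReal.ofReal_mul hc, mul_assoc]

/-- The weak type `(1, 1)` inequality for the maximal function. -/
theorem measure_lt_maximalFunction_le [OpensMeasurableSpace X] [SecondCountableTopology X]
    {μ : Measure X} {c Q : ℝ} (hc : 0 < c) (hQ : 0 < Q)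
    (hup : ∀ (x : X) (t : ℝ), 0 < t → μ (ball x t) ≤ ENNReal.ofReal (c * t ^ Q))
    (f : X → ℝ≥0∞) {l : ℝ} (hl : 0 < l) :
    μ {x | ENNReal.ofReal l < maximalFunction μ Q f x} ≤
      ENNReal.ofReal (c * 6 ^ Q / l) * ∫⁻ x, f x ∂μ := by
  have h6 : (0 : ℝ) < c * 6 ^ Q / l := by positivity
  by_cases hS : ∫⁻ x, f x ∂μ = ∞
  · rw [hS, ENNReal.mul_top (by simpa using h6)]
    exact le_top
  set S := (∫⁻ x, f x ∂μ).toReal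
  let T : Set (X × ℝ) :=
    {q | 0 < q.2 ∧ ENNReal.ofReal l * ENNReal.ofReal (q.2 ^ Q) < ∫⁻ z in ball q.1 q.2, f z ∂μ}
  -- The Vitali covering lemma needs bounded radii; finiteness of `∫ f` provides the bound.
  have hR : ∀ q ∈ T, q.2 ≤ (S / l) ^ Q⁻¹ := by
    rintro ⟨x, t⟩ ⟨ht, hlt⟩
    dsimp only at ht hlt ⊢
    have h1 : ENNReal.ofReal (l * t ^ Q) ≤ ENNReal.ofReal S := by
      rw [ENNReal.ofReal_toReal hS, ENNReal.ofReal_mul hl.le]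
      exact hlt.le.trans (setLIntegral_le_lintegral _ _)
    have h2 := (ENNReal.ofReal_le_ofReal_iff ENNReal.toReal_nonneg).1 h1
    have h3 : t ^ Q ≤ S / l := by rw [le_div_iff₀ hl]; linarith
    calc t = (t ^ Q) ^ Q⁻¹ := (Real.rpow_rpow_inv ht.le hQ.ne').symm
      _ ≤ _ := Real.rpow_le_rpow (by positivity) h3 (by positivity)
  obtain ⟨u, huT, hdisj, hcov⟩ := Vitali.exists_disjoint_subfamily_covering_enlargement_closedBall
    T Prod.fst Prod.snd _ hR 5 (by norm_num)
  have hdisj' : u.PairwiseDisjoint fun q : X × ℝ => ball q.1 q.2 :=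
    hdisj.mono fun q => ball_subset_closedBall
  have hcount : u.Countable := hdisj'.countable_of_isOpen (fun _ _ => isOpen_ball)
    (fun q hq => ⟨q.1, mem_ball_self (huT hq).1⟩)
  have hsub : {x | ENNReal.ofReal l < maximalFunction μ Q f x} ⊆
      ⋃ q ∈ u, ball q.1 (6 * q.2) := by
    intro x hx
    obtain ⟨t, ht, hlt⟩ := lt_maximalFunction_iff.1 hx
    obtain ⟨q, hq, hsub⟩ := hcov (x, t) ⟨ht, hlt⟩
    refine mem_iUnion₂.2 ⟨q, hq, ?_⟩
    have h1 : dist x q.1 ≤ 5 * q.2 := hsub (mem_closedBall_self ht.le)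
    have h2 := (huT hq).1
    rw [mem_ball]
    linarith
  have hterm : ∀ q : u, μ (ball q.1.1 (6 * q.1.2)) ≤
      ENNReal.ofReal (c * 6 ^ Q / l) * ∫⁻ z in ball q.1.1 q.1.2, f z ∂μ := by
    rintro ⟨⟨x, t⟩, hq⟩
    obtain ⟨ht, hlt⟩ := huT hq
    dsimp only at ht hlt ⊢
    calc μ (ball x (6 * t)) ≤ ENNReal.ofReal (c * (6 * t) ^ Q) := hup x _ (by linarith)
      _ = ENNReal.ofReal (c * 6 ^ Q / l) * (ENNReal.ofReal l * ENNReal.ofReal (t ^ Q)) := by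
        rw [← ENNReal.ofReal_mul hl.le, ← ENNReal.ofReal_mul h6.le,
          Real.mul_rpow (by norm_num) ht.le]
        congr 1
        field_simp
      _ ≤ _ := by gcongr
  calc μ {x | ENNReal.ofReal l < maximalFunction μ Q f x}
      ≤ μ (⋃ q ∈ u, ball q.1 (6 * q.2)) := measure_mono hsub
    _ ≤ ∑' q : u, μ (ball q.1.1 (6 * q.1.2)) := measure_biUnion_le μ hcount _
    _ ≤ ∑' q : u, ENNReal.ofReal (c * 6 ^ Q / l) * ∫⁻ z in ball q.1.1 q.1.2, f z ∂μ :=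
      ENNReal.tsum_le_tsum hterm
    _ = ENNReal.ofReal (c * 6 ^ Q / l) * ∫⁻ z in ⋃ q ∈ u, ball q.1 q.2, f z ∂μ := by
      rw [ENNReal.tsum_mul_left, lintegral_biUnion hcount (fun _ _ => measurableSet_ball) hdisj']
    _ ≤ ENNReal.ofReal (c * 6 ^ Q / l) * ∫⁻ x, f x ∂μ :=
      mul_le_mul_right (setLIntegral_le_lintegral _ _) _

/-- The Hardy-Littlewood maximal inequality in `L ^ p`, for bounded functions. -/
theorem lintegral_maximalFunction_rpow_le [OpensMeasurableSpace X] [SecondCountableTopology X]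
    {μ : Measure X} {c Q p : ℝ} (hc : 0 < c) (hQ : 0 < Q) (hp : 1 < p)
    (hup : ∀ (x : X) (t : ℝ), 0 < t → μ (ball x t) ≤ ENNReal.ofReal (c * t ^ Q)) :
    ∃ C : ℝ, 0 < C ∧ ∀ (f : X → ℝ≥0∞) (K : ℝ≥0∞), Measurable f → K ≠ ∞ → (∀ x, f x ≤ K) →
      ∫⁻ x, maximalFunction μ Q f x ^ p ∂μ ≤ ENNReal.ofReal C * ∫⁻ x, f x ^ p ∂μ := by
  have hp0 : 0 < p := by linarith
  have hp1 : 0 < p - 1 := by linarith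
  set A : ℝ := c * 6 ^ Q * 2 with hA
  have hApos : 0 < A := by positivity
  set B : ℝ := (2 * c) ^ (p - 1) with hB
  have hBpos : 0 < B := by positivity
  refine ⟨p * A * (p - 1)⁻¹ * B, by positivity, fun f K hf hK hfK => ?_⟩
  have hfK' : ∀ x, f x ≠ ∞ := fun x => ((hfK x).trans_lt hK.lt_top).ne
  have hMK : ∀ x, maximalFunction μ Q f x ≠ ∞ := fun x =>
    ((maximalFunction_le_of_le hc.le hup hfK x).trans_lt
      (ENNReal.mul_lt_top hK.lt_top ENNReal.ofReal_lt_top)).ne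
  -- The Fubini step is replaced by two layer cake formulas: for the maximal function under `μ` with
  -- exponent `p`, and for `F = 2 c f` under `f μ` with exponent `p - 1`. The weak type bound links
  -- their level sets.
  set ν := μ.withDensity f with hν
  set F : X → ℝ := fun x => 2 * c * (f x).toReal with hF
  have hFm : Measurable F := hf.ennreal_toReal.const_mul _
  have hF0 : ∀ x, 0 ≤ F x := fun x => by positivity
  have hlayer : ∀ t : ℝ, 0 < t → μ {x | t < (maximalFunction μ Q f x).toReal} ≤
      ENNReal.ofReal (A / t) * ν {x | t < F x} := by
    intro t ht
    set s : Set X := {x | t < F x}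
    have hs : MeasurableSet s := measurableSet_lt measurable_const hFm
    -- The height `t / (2c)` is chosen so that the maximal function of the bounded part is at most
    -- `t / 2`.
    have hsplit : ∀ x, f x ≤ s.indicator f x + ENNReal.ofReal (t / (2 * c)) := by
      intro x
      by_cases hx : x ∈ s
      · rw [indicator_of_mem hx]
        exact le_self_add
      · rw [indicator_of_notMem hx, zero_add, ← ENNReal.ofReal_toReal (hfK' x)]
        refine ENNReal.ofReal_le_ofReal ?_
        have : 2 * c * (f x).toReal ≤ t := not_lt.1 hx
        rw [le_div_iff₀ (by positivity)]
        linarith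
    have hsub : {x | t < (maximalFunction μ Q f x).toReal} ⊆
        {x | ENNReal.ofReal (t / 2) < maximalFunction μ Q (s.indicator f) x} := by
      intro x hx
      have h1 : ENNReal.ofReal t < maximalFunction μ Q f x :=
        (ENNReal.ofReal_lt_iff_lt_toReal ht.le (hMK x)).2 hx
      have h2 := (maximalFunction_mono (μ := μ) (Q := Q) hsplit x).trans
        (maximalFunction_add_le (hf.indicator hs) _ x)
      have h3 := maximalFunction_le_of_le (f := fun _ => ENNReal.ofReal (t / (2 * c))) hc.le hup
        (fun _ => le_rfl) x
      rw [← ENNReal.ofReal_mul (by positivity),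
        show t / (2 * c) * c = t / 2 by field_simp] at h3
      have h4 := h1.trans_le (h2.trans (add_le_add le_rfl h3))
      have h5 : ENNReal.ofReal t = ENNReal.ofReal (t / 2) + ENNReal.ofReal (t / 2) := by
        rw [← ENNReal.ofReal_add (by positivity) (by positivity), add_halves]
      rw [h5] at h4
      exact (ENNReal.add_lt_add_iff_right ENNReal.ofReal_ne_top).1 h4
    calc μ {x | t < (maximalFunction μ Q f x).toReal} ≤ _ := measure_mono hsub
      _ ≤ _ := measure_lt_maximalFunction_le hc hQ hup _ (half_pos ht)
      _ = ENNReal.ofReal (A / t) * ν {x | t < F x} := by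
        rw [lintegral_indicator hs, hν, withDensity_apply _ hs]
        congr 2
        rw [hA]
        field_simp
  calc ∫⁻ x, maximalFunction μ Q f x ^ p ∂μ
      = ∫⁻ x, ENNReal.ofReal ((maximalFunction μ Q f x).toReal ^ p) ∂μ := by
        refine lintegral_congr fun x => ?_
        rw [← ENNReal.ofReal_rpow_of_nonneg ENNReal.toReal_nonneg hp0.le,
          ENNReal.ofReal_toReal (hMK x)]
    _ = ENNReal.ofReal p * ∫⁻ t in Ioi (0 : ℝ),
          μ {x | t < (maximalFunction μ Q f x).toReal} * ENNReal.ofReal (t ^ (p - 1)) :=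
        lintegral_rpow_eq_lintegral_meas_lt_mul μ (ae_of_all _ fun _ => ENNReal.toReal_nonneg)
          (measurable_maximalFunction μ Q f).ennreal_toReal.aemeasurable hp0
    _ ≤ ENNReal.ofReal p * ∫⁻ t in Ioi (0 : ℝ), ENNReal.ofReal A *
          (ν {x | t < F x} * ENNReal.ofReal (t ^ (p - 1 - 1))) := by
        refine mul_le_mul_right ?_ _
        refine setLIntegral_mono' measurableSet_Ioi fun t ht => ?_
        have ht : 0 < t := ht
        refine (mul_le_mul_left (hlayer t ht) _).trans_eq ?_
        rw [mul_right_comm, ← ENNReal.ofReal_mul (by positivity), mul_left_comm,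
          ← ENNReal.ofReal_mul hApos.le, mul_comm]
        congr 2
        rw [Real.rpow_sub_one ht.ne' (p - 1)]
        field_simp
    _ = ENNReal.ofReal (p * A * (p - 1)⁻¹) * ∫⁻ x, ENNReal.ofReal (F x ^ (p - 1)) ∂ν := by
        rw [lintegral_const_mul' _ _ ENNReal.ofReal_ne_top,
          lintegral_rpow_eq_lintegral_meas_lt_mul ν (ae_of_all _ hF0) hFm.aemeasurable hp1,
          ← mul_assoc, ← mul_assoc, ← ENNReal.ofReal_mul hp0.le,
          ← ENNReal.ofReal_mul (by positivity)]
        congr 2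
        field_simp
    _ = ENNReal.ofReal (p * A * (p - 1)⁻¹) * ∫⁻ x, ENNReal.ofReal B * f x ^ p ∂μ := by
        congr 1
        rw [hν, lintegral_withDensity_eq_lintegral_mul _ hf (by fun_prop)]
        refine lintegral_congr fun x => ?_
        rw [Pi.mul_apply, hF, Real.mul_rpow (by positivity) ENNReal.toReal_nonneg,
          ENNReal.ofReal_mul hBpos.le,
          ← ENNReal.ofReal_rpow_of_nonneg ENNReal.toReal_nonneg hp1.le,
          ENNReal.ofReal_toReal (hfK' x), mul_left_comm]
        congr 1
        by_cases h0 : f x = 0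
        · rw [h0, zero_mul, ENNReal.zero_rpow_of_pos hp0]
        · nth_rewrite 1 [← ENNReal.rpow_one (f x)]
          rw [← ENNReal.rpow_add _ _ h0 (hfK' x)]
          congr 1
          ring
    _ = _ := by
        rw [lintegral_const_mul' _ _ ENNReal.ofReal_ne_top, ← mul_assoc,
          ← ENNReal.ofReal_mul (by positivity)]

end MaximalFunction

/-! ### Riesz potentials: annuli, oscillation and Hedberg estimates -/

section Potential

open Metric Set Filter Topology

variable {X : Type*} [MetricSpace X] [MeasurableSpace X]

/-- Summation over annuli `{τ k / 4 ≤ d(y, z) < τ k}` for an integral against `d(y, z) ^ (-s)`. -/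
theorem setLIntegral_div_dist_rpow_le_tsum [OpensMeasurableSpace X] {μ : Measure X}
    {f : X → ℝ≥0∞} {y : X} (hy : μ {y} = 0) {S : Set X} {τ : ℕ → ℝ} (hτ : ∀ k, 0 < τ k)
    (hS : ∀ z ∈ S, z ≠ y → ∃ k, τ k / 4 ≤ dist z y ∧ dist z y < τ k) {A : ℝ≥0∞} {a s : ℝ}
    (hs : 0 ≤ s) (hA : ∀ k, ∫⁻ z in ball y (τ k), f z ∂μ ≤ A * ENNReal.ofReal (τ k ^ a)) :
    ∫⁻ z in S, f z / ENNReal.ofReal (dist y z ^ s) ∂μ ≤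
      A * (ENNReal.ofReal (4 ^ s) * ∑' k, ENNReal.ofReal (τ k ^ (a - s))) := by
  let R : ℕ → Set X := fun k => ball y (τ k) \ ball y (τ k / 4)
  have hsub : S ⊆ {y} ∪ ⋃ k, R k := by
    intro z hz
    by_cases hzy : z = y
    · exact Or.inl hzy
    · obtain ⟨k, h1, h2⟩ := hS z hz hzy
      exact Or.inr (mem_iUnion.2 ⟨k, h2, fun h => absurd (mem_ball.1 h) (not_lt.2 h1)⟩)
  have hterm : ∀ k, ∫⁻ z in R k, f z / ENNReal.ofReal (dist y z ^ s) ∂μ ≤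
      A * (ENNReal.ofReal (4 ^ s) * ENNReal.ofReal (τ k ^ (a - s))) := by
    intro k
    have hk := hτ k
    have hpos : 0 < (τ k / 4) ^ s := by positivity
    calc ∫⁻ z in R k, f z / ENNReal.ofReal (dist y z ^ s) ∂μ
        ≤ ∫⁻ z in R k, f z * (ENNReal.ofReal ((τ k / 4) ^ s))⁻¹ ∂μ := by
          refine setLIntegral_mono' (measurableSet_ball.diff measurableSet_ball) fun z hz => ?_
          rw [div_eq_mul_inv]
          have h1 : τ k / 4 ≤ dist y z := by
            rw [dist_comm]
            exact not_lt.1 fun h => hz.2 (mem_ball.2 h)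
          gcongr
      _ ≤ ∫⁻ z in ball y (τ k), f z * (ENNReal.ofReal ((τ k / 4) ^ s))⁻¹ ∂μ :=
          lintegral_mono_set sdiff_subset
      _ = (∫⁻ z in ball y (τ k), f z ∂μ) * (ENNReal.ofReal ((τ k / 4) ^ s))⁻¹ :=
          lintegral_mul_const' _ _ (by simpa using hpos)
      _ ≤ A * ENNReal.ofReal (τ k ^ a) * (ENNReal.ofReal ((τ k / 4) ^ s))⁻¹ := by
          gcongr
          exact hA k
      _ = _ := by
          rw [mul_assoc, ← ENNReal.ofReal_inv_of_pos hpos, ← ENNReal.ofReal_mul (by positivity),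
            ← ENNReal.ofReal_mul (by positivity), Real.rpow_sub hk, Real.div_rpow hk.le (by norm_num)]
          congr 2
          field_simp
  calc ∫⁻ z in S, f z / ENNReal.ofReal (dist y z ^ s) ∂μ
      ≤ ∫⁻ z in {y} ∪ ⋃ k, R k, f z / ENNReal.ofReal (dist y z ^ s) ∂μ := lintegral_mono_set hsub
    _ ≤ ∫⁻ z in {y}, f z / ENNReal.ofReal (dist y z ^ s) ∂μ +
          ∫⁻ z in ⋃ k, R k, f z / ENNReal.ofReal (dist y z ^ s) ∂μ := lintegral_union_le _ _ _
    _ ≤ 0 + ∑' k, ∫⁻ z in R k, f z / ENNReal.ofReal (dist y z ^ s) ∂μ :=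
        add_le_add (setLIntegral_measure_zero _ _ hy).le (lintegral_iUnion_le _ _)
    _ ≤ ∑' k, A * (ENNReal.ofReal (4 ^ s) * ENNReal.ofReal (τ k ^ (a - s))) := by
        rw [zero_add]
        exact ENNReal.tsum_le_tsum hterm
    _ = _ := by rw [ENNReal.tsum_mul_left, ENNReal.tsum_mul_left]

theorem tsum_ofReal_mul_pow_le {b q : ℝ} (hb : 0 ≤ b) (hq0 : 0 ≤ q) (hq1 : q < 1) :
    ∑' k : ℕ, ENNReal.ofReal (b * q ^ k) ≤ ENNReal.ofReal (b * (1 - q)⁻¹) := by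
  have h := (hasSum_geometric_of_lt_one hq0 hq1).mul_left b
  rw [← ENNReal.ofReal_tsum_of_nonneg (fun n => by positivity) h.summable, h.tsum_eq]

/-- The integral of `f(z) d(y, z) ^ (-s)` over a ball, when `f` has mass `O(t ^ a)`, `a > s`, in
`B(y, t)`. -/
theorem exists_setLIntegral_ball_div_dist_rpow_le [OpensMeasurableSpace X] (μ : Measure X)
    {a s : ℝ} (hs : 0 ≤ s) (has : s < a) :
    ∃ C : ℝ, 0 < C ∧ ∀ (f : X → ℝ≥0∞) (y : X) (r : ℝ) (A : ℝ≥0∞), μ {y} = 0 → 0 < r →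
      (∀ t, 0 < t → ∫⁻ z in ball y t, f z ∂μ ≤ A * ENNReal.ofReal (t ^ a)) →
      ∫⁻ z in ball y r, f z / ENNReal.ofReal (dist y z ^ s) ∂μ ≤
        A * ENNReal.ofReal (C * r ^ (a - s)) := by
  set q : ℝ := 2⁻¹ ^ (a - s)
  have hq0 : 0 ≤ q := by positivity
  have hq1 : q < 1 := Real.rpow_lt_one (by norm_num) (by norm_num) (by linarith)
  have hq2 : 0 < (1 - q)⁻¹ := inv_pos.2 (by linarith)
  refine ⟨4 ^ s * (1 - q)⁻¹, by positivity, fun f y r A hy hr hA => ?_⟩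
  have hτ : ∀ k : ℕ, 0 < r * 2⁻¹ ^ k := fun k => by positivity
  refine (setLIntegral_div_dist_rpow_le_tsum hy (τ := fun k => r * 2⁻¹ ^ k) hτ ?_ hs
    fun k => hA _ (hτ k)).trans ?_
  · intro z hz hzy
    have hd : 0 < dist z y := dist_pos.2 hzy
    have hdr : dist z y < r := hz
    -- This gives `r 2⁻⁽ⁿ⁺¹⁾ < d ≤ r 2⁻ⁿ`, with the strict inequality at the wrong end. The annuli
    -- of ratio 4 overlap, so shifting the index down by one repairs it; for index 0 the open ball
    -- already gives `d < r`.
    obtain ⟨n, h1, h2⟩ := exists_nat_pow_near_of_lt_one (div_pos hd hr)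
      ((div_le_one hr).2 hdr.le) (y := (2⁻¹ : ℝ)) (by norm_num) (by norm_num)
    rw [lt_div_iff₀ hr, pow_succ] at h1
    rw [div_le_iff₀ hr] at h2
    cases n with
    | zero =>
      refine ⟨0, ?_, ?_⟩
      · simp only [pow_zero, one_mul, mul_one] at h1 ⊢
        linarith
      · simpa using hdr
    | succ n =>
      refine ⟨n, ?_, ?_⟩
      · rw [pow_succ] at h1
        linarith
      · rw [pow_succ] at h2
        nlinarith [hτ n]
  · have hterm : ∀ k : ℕ, (r * 2⁻¹ ^ k) ^ (a - s) = r ^ (a - s) * q ^ k := fun k => by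
      rw [Real.mul_rpow hr.le (by positivity), ← Real.rpow_natCast, ← Real.rpow_natCast,
        ← Real.rpow_mul (by norm_num), ← Real.rpow_mul (by norm_num), mul_comm (k : ℝ)]
    simp only [hterm]
    gcongr
    refine (mul_le_mul_right (tsum_ofReal_mul_pow_le (by positivity) hq0 hq1) _).trans_eq ?_
    rw [← ENNReal.ofReal_mul (by positivity)]
    congr 1
    ring

/-- The integral of `f(z) d(y, z) ^ (-s)` outside a ball, when `f` has mass `O(t ^ a)`, `a < s`, in
`B(y, t)`. -/
theorem exists_setLIntegral_compl_ball_div_dist_rpow_le [OpensMeasurableSpace X] (μ : Measure X)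
    {a s : ℝ} (hs : 0 ≤ s) (has : a < s) :
    ∃ C : ℝ, 0 < C ∧ ∀ (f : X → ℝ≥0∞) (y : X) (r : ℝ) (A : ℝ≥0∞), μ {y} = 0 → 0 < r →
      (∀ t, 0 < t → ∫⁻ z in ball y t, f z ∂μ ≤ A * ENNReal.ofReal (t ^ a)) →
      ∫⁻ z in (ball y r)ᶜ, f z / ENNReal.ofReal (dist y z ^ s) ∂μ ≤
        A * ENNReal.ofReal (C * r ^ (a - s)) := by
  set q : ℝ := 2 ^ (a - s)
  have hq0 : 0 ≤ q := by positivity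
  have hq1 : q < 1 := Real.rpow_lt_one_of_one_lt_of_neg (by norm_num) (by linarith)
  have hq2 : 0 < (1 - q)⁻¹ := inv_pos.2 (by linarith)
  refine ⟨4 ^ s * (2 ^ (a - s) * (1 - q)⁻¹), by positivity, fun f y r A hy hr hA => ?_⟩
  have hτ : ∀ k : ℕ, 0 < 2 * r * 2 ^ k := fun k => by positivity
  refine (setLIntegral_div_dist_rpow_le_tsum hy (τ := fun k => 2 * r * 2 ^ k) hτ ?_ hs
    fun k => hA _ (hτ k)).trans ?_
  · intro z hz _
    have hdr : r ≤ dist z y := not_lt.1 hz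
    obtain ⟨n, h1, h2⟩ := exists_nat_pow_near ((one_le_div hr).2 hdr) (y := (2 : ℝ)) (by norm_num)
    rw [le_div_iff₀ hr] at h1
    rw [div_lt_iff₀ hr, pow_succ] at h2
    refine ⟨n, ?_, ?_⟩ <;> nlinarith [hτ n]
  · have hterm : ∀ k : ℕ, (2 * r * 2 ^ k) ^ (a - s) = (2 * r) ^ (a - s) * q ^ k := fun k => by
      rw [Real.mul_rpow (by positivity) (by positivity), ← Real.rpow_natCast, ← Real.rpow_natCast,
        ← Real.rpow_mul (by norm_num), ← Real.rpow_mul (by norm_num), mul_comm (k : ℝ)]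
    simp only [hterm]
    gcongr
    refine (mul_le_mul_right (tsum_ofReal_mul_pow_le (by positivity) hq0 hq1) _).trans_eq ?_
    rw [← ENNReal.ofReal_mul (by positivity), Real.mul_rpow (by norm_num) hr.le]
    congr 1
    ring

/-- The convex function `t ↦ t ^ (-s)` lies above its tangent at `a`. In scaled form this is `(1 +
q) ^ (-s) ≥ 1 - s q`, obtained from `log (1 + q) ≤ q` and `exp t ≥ 1 + t`. -/
theorem inv_rpow_le_inv_rpow_add {a b δ s : ℝ} (ha : 0 < a) (hb : 0 < b) (hδ : 0 ≤ δ) (hs : 0 ≤ s)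
    (hab : b ≤ a + δ) : (a ^ s)⁻¹ ≤ (b ^ s)⁻¹ + s * δ * (a ^ (s + 1))⁻¹ := by
  have h1 : ((a + δ) ^ s)⁻¹ ≤ (b ^ s)⁻¹ := by gcongr
  refine le_trans ?_ (add_le_add h1 le_rfl)
  have hq : 0 < 1 + δ / a := by positivity
  have h2 : a + δ = a * (1 + δ / a) := by field_simp
  have h3 : 1 - s * (δ / a) ≤ ((1 + δ / a) ^ s)⁻¹ := by
    rw [← Real.rpow_neg hq.le, Real.rpow_def_of_pos hq]
    have h4 := Real.add_one_le_exp (Real.log (1 + δ / a) * -s)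
    have h5 := Real.log_le_sub_one_of_pos hq
    nlinarith
  rw [h2, Real.mul_rpow ha.le hq.le, mul_inv, Real.rpow_add_one ha.ne', mul_inv]
  have h6 : 0 < (a ^ s)⁻¹ := by positivity
  have h7 := mul_le_mul_of_nonneg_left h3 h6.le
  have h8 : s * δ * ((a ^ s)⁻¹ * a⁻¹) = (a ^ s)⁻¹ * (s * (δ / a)) := by
    rw [div_eq_mul_inv]; ring
  rw [h8]
  linarith

/-- The Hajłasz type oscillation estimate for the Riesz potential by the maximal function. -/
theorem exists_rieszPotentialOfDim_le_add [OpensMeasurableSpace X] {μ : Measure X} {Q β : ℝ}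
    (hβ0 : 0 < β) (hβ1 : β < 1) (hβQ : β < Q) (hμ : ∀ x : X, μ {x} = 0) :
    ∃ C : ℝ, 0 < C ∧ ∀ (f : X → ℝ≥0∞), Measurable f → ∀ x y : X,
      rieszPotentialOfDim μ Q β f x ≤ rieszPotentialOfDim μ Q β f y +
        ENNReal.ofReal (C * dist x y ^ β) * maximalFunction μ Q f x := by
  obtain ⟨C₁, hC₁, h₁⟩ := exists_setLIntegral_ball_div_dist_rpow_le μ (a := Q) (s := Q - β)
    (by linarith) (by linarith)
  -- Differencing the kernel gains one power of decay, so the tail converges precisely because `β <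
  -- 1`.
  obtain ⟨C₂, hC₂, h₂⟩ := exists_setLIntegral_compl_ball_div_dist_rpow_le μ (a := Q)
    (s := Q - β + 1) (by linarith) (by linarith)
  have hs : 0 < Q - β := by linarith
  refine ⟨C₁ + (Q - β) * C₂, by positivity, fun f hf x y => ?_⟩
  rcases eq_or_ne x y with rfl | hxy
  · exact le_self_add
  set δ := dist x y
  have hδ : 0 < δ := dist_pos.2 hxy
  have hM : ∀ t : ℝ, 0 < t → ∫⁻ z in ball x t, f z ∂μ ≤
      maximalFunction μ Q f x * ENNReal.ofReal (t ^ Q) :=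
    fun t ht => setLIntegral_ball_le_maximalFunction f x ht
  have hnear := h₁ f x δ _ (hμ x) hδ hM
  have hfar := h₂ f x δ _ (hμ x) hδ hM
  have hdist : ∀ w : X, Measurable fun z => dist w z := fun w =>
    (by fun_prop : Continuous fun z => dist w z).measurable
  have hpt : ∀ z ∈ (ball x δ)ᶜ, f z / ENNReal.ofReal (dist x z ^ (Q - β)) ≤
      f z / ENNReal.ofReal (dist y z ^ (Q - β)) +
        ENNReal.ofReal ((Q - β) * δ) * (f z / ENNReal.ofReal (dist x z ^ (Q - β + 1))) := by
    intro z hz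
    have ha : δ ≤ dist x z := by rw [dist_comm]; exact not_lt.1 hz
    have ha0 : 0 < dist x z := hδ.trans_le ha
    have hinv : (ENNReal.ofReal (dist x z ^ (Q - β)))⁻¹ ≤
        (ENNReal.ofReal (dist y z ^ (Q - β)))⁻¹ +
          ENNReal.ofReal ((Q - β) * δ) * (ENNReal.ofReal (dist x z ^ (Q - β + 1)))⁻¹ := by
      -- At `z = y` the kernel on the right is `0⁻¹ = ∞`, so there is nothing to prove.
      rcases eq_or_ne y z with rfl | hyz
      · simp [Real.zero_rpow hs.ne']
      · have hb0 : 0 < dist y z := dist_pos.2 hyz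
        rw [← ENNReal.ofReal_inv_of_pos (by positivity), ← ENNReal.ofReal_inv_of_pos (by positivity),
          ← ENNReal.ofReal_inv_of_pos (by positivity), ← ENNReal.ofReal_mul (by positivity),
          ← ENNReal.ofReal_add (by positivity) (by positivity)]
        refine ENNReal.ofReal_le_ofReal (inv_rpow_le_inv_rpow_add ha0 hb0 hδ.le hs.le ?_)
        have h := dist_triangle y x z
        rw [dist_comm y x] at h
        linarith
    calc f z / ENNReal.ofReal (dist x z ^ (Q - β))
        = f z * (ENNReal.ofReal (dist x z ^ (Q - β)))⁻¹ := div_eq_mul_inv _ _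
      _ ≤ f z * _ := mul_le_mul_right hinv _
      _ = _ := by
        rw [mul_add, mul_left_comm, div_eq_mul_inv, div_eq_mul_inv]
  calc rieszPotentialOfDim μ Q β f x
      = ∫⁻ z in ball x δ, f z / ENNReal.ofReal (dist x z ^ (Q - β)) ∂μ +
          ∫⁻ z in (ball x δ)ᶜ, f z / ENNReal.ofReal (dist x z ^ (Q - β)) ∂μ :=
        (lintegral_add_compl _ measurableSet_ball).symm
    _ ≤ maximalFunction μ Q f x * ENNReal.ofReal (C₁ * δ ^ (Q - (Q - β))) +
          ∫⁻ z in (ball x δ)ᶜ, (f z / ENNReal.ofReal (dist y z ^ (Q - β)) +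
            ENNReal.ofReal ((Q - β) * δ) * (f z / ENNReal.ofReal (dist x z ^ (Q - β + 1)))) ∂μ :=
        add_le_add hnear (setLIntegral_mono' measurableSet_ball.compl hpt)
    _ ≤ maximalFunction μ Q f x * ENNReal.ofReal (C₁ * δ ^ (Q - (Q - β))) +
          (rieszPotentialOfDim μ Q β f y + ENNReal.ofReal ((Q - β) * δ) *
            (maximalFunction μ Q f x * ENNReal.ofReal (C₂ * δ ^ (Q - (Q - β + 1))))) := by
        rw [lintegral_add_left (by have := hdist y; fun_prop),
          lintegral_const_mul' _ _ ENNReal.ofReal_ne_top]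
        gcongr
        exact setLIntegral_le_lintegral _ _
    _ = _ := by
        rw [add_left_comm, mul_left_comm, ← mul_add, ← ENNReal.ofReal_mul (by positivity),
          ← ENNReal.ofReal_add (by positivity) (by positivity), mul_comm (maximalFunction μ Q f x)]
        congr 3
        rw [show Q - (Q - β) = β by ring, show Q - (Q - β + 1) = β - 1 by ring,
          Real.rpow_sub_one hδ.ne']
        field_simp

/-- Hölder's inequality against the constant 1. The growth exponent `Q (1 - 1/p)` is smaller than
the `Q` given by the maximal function, so it can serve for the tail of the potential. -/
theorem setLIntegral_ball_le_rpow_mul {μ : Measure X} [OpensMeasurableSpace X] {c Q p : ℝ}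
    (hc : 0 < c) (hp : 1 < p)
    (hup : ∀ (x : X) (t : ℝ), 0 < t → μ (ball x t) ≤ ENNReal.ofReal (c * t ^ Q))
    {f : X → ℝ≥0∞} (hf : Measurable f) (y : X) {t : ℝ} (ht : 0 < t) :
    ∫⁻ z in ball y t, f z ∂μ ≤ (∫⁻ z, f z ^ p ∂μ) ^ (1 / p) * ENNReal.ofReal (c ^ (1 - 1 / p)) *
      ENNReal.ofReal (t ^ (Q * (1 - 1 / p))) := by
  have hpq : p.HolderConjugate (p.conjExponent) := Real.HolderConjugate.conjExponent hp
  have hq : 1 / p.conjExponent = 1 - 1 / p := by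
    have := hpq.inv_add_inv_eq_one
    rw [one_div, one_div]
    linarith
  have hq0 : 0 ≤ 1 - 1 / p := by rw [← hq]; have := hpq.symm.pos; positivity
  have h := ENNReal.lintegral_mul_le_Lp_mul_Lq (μ.restrict (ball y t)) hpq (f := f)
    (g := fun _ => 1) hf.aemeasurable aemeasurable_const
  simp only [Pi.mul_apply, mul_one, ENNReal.one_rpow, lintegral_const, one_mul,
    Measure.restrict_apply_univ, hq] at h
  refine h.trans ?_
  rw [mul_assoc]
  gcongr
  · exact Measure.restrict_le_self
  · calc μ (ball y t) ^ (1 - 1 / p) ≤ ENNReal.ofReal (c * t ^ Q) ^ (1 - 1 / p) := by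
          gcongr
          exact hup y t ht
      _ = _ := by
          rw [ENNReal.ofReal_rpow_of_nonneg (by positivity) hq0,
            Real.mul_rpow hc.le (by positivity), ← Real.rpow_mul ht.le,
            ENNReal.ofReal_mul (by positivity)]

/-- Hedberg type estimate: the Riesz potential at scale `r` is controlled by the maximal function
and the `L ^ p` norm. -/
theorem exists_rieszPotentialOfDim_le [OpensMeasurableSpace X] {μ : Measure X} {c Q β p : ℝ}
    (hc : 0 < c) (hβ0 : 0 < β) (hp : 1 < p) (hβQ : β * p < Q) (hμ : ∀ x : X, μ {x} = 0)
    (hup : ∀ (x : X) (t : ℝ), 0 < t → μ (ball x t) ≤ ENNReal.ofReal (c * t ^ Q)) :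
    ∃ C : ℝ, 0 < C ∧ ∀ (f : X → ℝ≥0∞), Measurable f → ∀ (y : X) (r : ℝ), 0 < r →
      rieszPotentialOfDim μ Q β f y ≤ ENNReal.ofReal (C * r ^ β) * maximalFunction μ Q f y +
        ENNReal.ofReal (C * r ^ (β - Q / p)) * (∫⁻ z, f z ^ p ∂μ) ^ (1 / p) := by
  have hp0 : 0 < p := by linarith
  have hβQ' : β < Q := by nlinarith
  have hβp : β < Q / p := (lt_div_iff₀ hp0).2 hβQ
  obtain ⟨C₁, hC₁, h₁⟩ := exists_setLIntegral_ball_div_dist_rpow_le μ (a := Q) (s := Q - β)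
    (by linarith) (by linarith)
  -- The tail converges when `Q (1 - 1/p) < Q - β`, that is, when `β p < Q`.
  obtain ⟨C₂, hC₂, h₂⟩ := exists_setLIntegral_compl_ball_div_dist_rpow_le μ
    (a := Q * (1 - 1 / p)) (s := Q - β) (by linarith) (by
      have : Q * (1 - 1 / p) = Q - Q / p := by ring
      linarith)
  refine ⟨C₁ + c ^ (1 - 1 / p) * C₂, by positivity, fun f hf y r hr => ?_⟩
  have hnear := h₁ f y r _ (hμ y) hr fun t ht => setLIntegral_ball_le_maximalFunction f y ht
  have hfar := h₂ f y r _ (hμ y) hr fun t ht => setLIntegral_ball_le_rpow_mul hc hp hup hf y ht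
  calc rieszPotentialOfDim μ Q β f y
      = ∫⁻ z in ball y r, f z / ENNReal.ofReal (dist y z ^ (Q - β)) ∂μ +
          ∫⁻ z in (ball y r)ᶜ, f z / ENNReal.ofReal (dist y z ^ (Q - β)) ∂μ :=
        (lintegral_add_compl _ measurableSet_ball).symm
    _ ≤ _ := add_le_add hnear hfar
    _ ≤ _ := by
      refine add_le_add ?_ ?_
      · rw [mul_comm, show Q - (Q - β) = β by ring]
        gcongr
        have : 0 < c ^ (1 - 1 / p) * C₂ := by positivity
        linarith
      · rw [mul_assoc, mul_comm, ← ENNReal.ofReal_mul (by positivity), ← mul_assoc,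
          show Q * (1 - 1 / p) - (Q - β) = β - Q / p by ring]
        gcongr
        linarith

end Potential

/-! ### Hölder functions and cutoffs -/

section Cutoff

open Metric Set Filter Topology

variable {X : Type*} [MetricSpace X]

theorem IsHolderFun.continuous {β : ℝ} (hβ : 0 < β) {u : X → ℝ} (hu : IsHolderFun β u) :
    Continuous u := by
  obtain ⟨κ, -, h⟩ := hu
  refine continuous_iff_continuousAt.2 fun y => tendsto_iff_dist_tendsto_zero.2 ?_
  have hlim : Tendsto (fun z => κ * dist z y ^ β) (𝓝 y) (𝓝 0) := by
    have h1 : ContinuousAt (fun z => κ * dist z y ^ β) y := by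
      exact continuousAt_const.mul (ContinuousAt.rpow_const (by fun_prop) (Or.inr hβ.le))
    have h2 := h1.tendsto
    simpa [Real.zero_rpow hβ.ne'] using h2
  exact squeeze_zero (fun _ => dist_nonneg) (fun z => by simpa [Real.dist_eq] using h z y) hlim

/-- A cutoff function which is `1` on `closedBall x r` and vanishes off `ball x (2 * r)`. -/
def cutoff (x : X) (r : ℝ) (y : X) : ℝ := max 0 (min 1 (2 - dist y x / r))

theorem cutoff_nonneg (x : X) (r : ℝ) (y : X) : 0 ≤ cutoff x r y := le_max_left _ _

theorem cutoff_le_one (x : X) (r : ℝ) (y : X) : cutoff x r y ≤ 1 :=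
  max_le zero_le_one (min_le_left _ _)

theorem cutoff_eq_one {x : X} {r : ℝ} (hr : 0 < r) {y : X} (hy : y ∈ closedBall x r) :
    cutoff x r y = 1 := by
  have h : dist y x / r ≤ 1 := (div_le_one hr).2 hy
  rw [cutoff, min_eq_left (by linarith), max_eq_right zero_le_one]

theorem cutoff_eq_zero {x : X} {r : ℝ} (hr : 0 < r) {y : X} (hy : y ∉ ball x (2 * r)) :
    cutoff x r y = 0 := by
  have h : 2 ≤ dist y x / r := (le_div_iff₀ hr).2 (not_lt.1 hy)
  exact max_eq_left ((min_le_right _ _).trans (by linarith))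

/-- The cutoff is `1/r`-Lipschitz and `t ≤ t ^ β` for `t ≤ 1`; at distances above `r`, its
oscillation of at most 1 suffices. -/
theorem cutoff_sub_le {x : X} {r : ℝ} (hr : 0 < r) {β : ℝ} (hβ0 : 0 < β) (hβ1 : β ≤ 1) (y z : X) :
    cutoff x r y - cutoff x r z ≤ (dist y z / r) ^ β := by
  have hd : 0 ≤ dist y z / r := by positivity
  rcases le_total (dist y z / r) 1 with h1 | h1
  · refine le_trans ?_ (Real.self_le_rpow_of_le_one hd h1 hβ1)
    have h2 : dist z x / r ≤ dist y x / r + dist y z / r := by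
      rw [← add_div]
      gcongr
      linarith [dist_triangle z y x, dist_comm y z]
    rw [sub_le_iff_le_add, cutoff]
    refine max_le (add_nonneg hd (cutoff_nonneg _ _ _)) ?_
    rcases le_total 1 (2 - dist z x / r) with h3 | h3
    · have : cutoff x r z = 1 := by rw [cutoff, min_eq_left h3, max_eq_right zero_le_one]
      rw [this]
      exact (min_le_left _ _).trans (by linarith)
    · have : 2 - dist z x / r ≤ cutoff x r z := by
        rw [cutoff, min_eq_right h3]
        exact le_max_right _ _
      exact (min_le_right _ _).trans (by linarith)
  · have := Real.one_le_rpow h1 hβ0.le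
    linarith [cutoff_nonneg x r z, cutoff_le_one x r y]

end Cutoff

/-! ### Hajłasz capacity bounded by Riesz capacity -/

section CapacityUpperBound

open Metric Set Filter Topology

variable {X : Type*} [MetricSpace X] [MeasurableSpace X]

/-- Capacity estimate by the cut off potential of a bounded function. -/
theorem exists_hajlaszCapacity_le_of_bounded [OpensMeasurableSpace X] [SecondCountableTopology X]
    {μ : Measure X} {c Q β p : ℝ} (hc : 0 < c) (hβ0 : 0 < β) (hβ1 : β < 1) (hp : 1 < p)
    (hβQ : β * p < Q) (hμ : ∀ x : X, μ {x} = 0)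
    (hup : ∀ (x : X) (t : ℝ), 0 < t → μ (ball x t) ≤ ENNReal.ofReal (c * t ^ Q)) :
    ∃ C : ℝ, 0 < C ∧ ∀ (f : X → ℝ≥0∞) (K : ℝ≥0∞), Measurable f → K ≠ ∞ → (∀ x, f x ≤ K) →
      ∫⁻ x, f x ^ p ∂μ ≠ ∞ →
      IsHolderFun β (fun y => (rieszPotentialOfDim μ Q β f y).toReal) ∧
      (∀ y, rieszPotentialOfDim μ Q β f y ≠ ∞) ∧
      ∀ (F : Set X) (x : X) (r : ℝ), 0 < r → F ⊆ closedBall x r →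
        (∀ y ∈ F, 2⁻¹ < rieszPotentialOfDim μ Q β f y) →
        hajlaszCapacity μ β p F (ball x (2 * r)) ≤ ENNReal.ofReal C * ∫⁻ x, f x ^ p ∂μ := by
  have hp0 : 0 < p := by linarith
  have hβQ' : β < Q := by nlinarith
  have hQ : 0 < Q := by linarith
  obtain ⟨C₁, hC₁, hosc⟩ := exists_rieszPotentialOfDim_le_add (Q := Q) hβ0 hβ1 hβQ' hμ
  obtain ⟨C₂, hC₂, hhed⟩ := exists_rieszPotentialOfDim_le hc hβ0 hp hβQ hμ hup
  obtain ⟨C₃, hC₃, hmax⟩ := lintegral_maximalFunction_rpow_le hc hQ hp hup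
  refine ⟨2 ^ (p - 1) * ((2 * C₁ + 2 * C₂) ^ p * C₃ + (2 * C₂) ^ p * (c * 2 ^ Q)), by positivity,
    fun f K hf hK hfK hfp => ?_⟩
  set N : ℝ≥0∞ := (∫⁻ x, f x ^ p ∂μ) ^ (1 / p) with hN
  have hNfin : N ≠ ∞ := ENNReal.rpow_ne_top_of_nonneg (by positivity) hfp
  set M := maximalFunction μ Q f with hM
  set P := rieszPotentialOfDim μ Q β f with hP
  have hMle : ∀ y, M y ≤ K * ENNReal.ofReal c := maximalFunction_le_of_le hc.le hup hfK
  have hM₀ : K * ENNReal.ofReal c ≠ ∞ := ENNReal.mul_ne_top hK ENNReal.ofReal_ne_top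
  have hMfin : ∀ y, M y ≠ ∞ := fun y => ne_top_of_le_ne_top hM₀ (hMle y)
  -- The Hedberg bound at scale 1. Only finiteness of `V` matters: it bounds the potential and makes
  -- the test function Hölder, and it does not enter the final constant.
  set V : ℝ≥0∞ := ENNReal.ofReal (C₂ * 1 ^ β) * (K * ENNReal.ofReal c) +
    ENNReal.ofReal (C₂ * 1 ^ (β - Q / p)) * N with hV
  have hVfin : V ≠ ∞ := ENNReal.add_ne_top.2 ⟨ENNReal.mul_ne_top ENNReal.ofReal_ne_top hM₀,
    ENNReal.mul_ne_top ENNReal.ofReal_ne_top hNfin⟩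
  have hPle : ∀ y, P y ≤ V := fun y => (hhed f hf y 1 one_pos).trans (by
    rw [hV]
    gcongr
    exact hMle y)
  have hPfin : ∀ y, P y ≠ ∞ := fun y => ne_top_of_le_ne_top hVfin (hPle y)
  set m : X → ℝ := fun y => (M y).toReal with hm
  set v : X → ℝ := fun y => (P y).toReal with hv
  have hm0 : ∀ y, 0 ≤ m y := fun y => ENNReal.toReal_nonneg
  have hv0 : ∀ y, 0 ≤ v y := fun y => ENNReal.toReal_nonneg
  have hmle : ∀ y, m y ≤ (K * ENNReal.ofReal c).toReal := fun y => ENNReal.toReal_mono hM₀ (hMle y)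
  have hvle : ∀ y, v y ≤ V.toReal := fun y => ENNReal.toReal_mono hVfin (hPle y)
  have hvosc : ∀ y z, v y - v z ≤ C₁ * dist y z ^ β * m y := by
    intro y z
    have h1 := ENNReal.toReal_mono (ENNReal.add_ne_top.2 ⟨hPfin z, ENNReal.mul_ne_top
      ENNReal.ofReal_ne_top (hMfin y)⟩) (hosc f hf y z)
    rw [ENNReal.toReal_add (hPfin z) (ENNReal.mul_ne_top ENNReal.ofReal_ne_top (hMfin y)),
      ENNReal.toReal_mul, ENNReal.toReal_ofReal (by positivity)] at h1
    have : v y ≤ v z + C₁ * dist y z ^ β * m y := h1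
    linarith
  have hvhol : IsHolderFun β v := by
    refine ⟨C₁ * (K * ENNReal.ofReal c).toReal, by positivity, fun y z => ?_⟩
    have hb : ∀ y z, C₁ * dist y z ^ β * m y ≤
        C₁ * (K * ENNReal.ofReal c).toReal * dist y z ^ β := fun y z => by
      rw [mul_right_comm]
      gcongr
      exact hmle y
    refine abs_sub_le_iff.2 ⟨(hvosc y z).trans (hb y z), (hvosc z y).trans ?_⟩
    rw [dist_comm y z]
    exact hb z y
  refine ⟨hvhol, hPfin, fun F x r hr hFr hF => ?_⟩
  set R := r ^ (-β) with hR
  have hR0 : 0 < R := by positivity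
  -- The factor 2 compensates for the potential being only above `1/2` on `F`.
  set u : X → ℝ := fun y => 2 * (cutoff x r y * v y) with hu
  set G : X → ℝ := (ball x (2 * r)).indicator fun y => 2 * (C₁ * m y + R * v y) with hG
  have hG0 : ∀ y, 0 ≤ G y := fun y => indicator_nonneg (fun y _ => by
    have := hm0 y
    have := hv0 y
    positivity) y
  have hcut : ∀ y z, cutoff x r y - cutoff x r z ≤ dist y z ^ β * R := fun y z => by
    refine (cutoff_sub_le hr hβ0 hβ1.le y z).trans_eq ?_
    rw [hR, Real.div_rpow dist_nonneg hr.le, Real.rpow_neg hr.le, div_eq_mul_inv]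
  -- Product rule: with `η` the cutoff, `η y v y - η z v z = η y (v y - v z) + (η y - η z) v z`. If
  -- `z` is outside the ball then `η z = 0`, and the term `R v y` in `G y` suffices.
  have huosc : ∀ y z, u y - u z ≤ dist y z ^ β * (G y + G z) := by
    intro y z
    have hd : 0 ≤ dist y z ^ β := by positivity
    by_cases hy : y ∈ ball x (2 * r)
    · have hGy : G y = 2 * (C₁ * m y + R * v y) := indicator_of_mem hy _
      by_cases hz : z ∈ ball x (2 * r)
      · have hGz : G z = 2 * (C₁ * m z + R * v z) := indicator_of_mem hz _
        have h1 := mul_le_mul_of_nonneg_left (hvosc y z) (cutoff_nonneg x r y)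
        have h2 := mul_le_mul_of_nonneg_right (hcut y z) (hv0 z)
        have h3 : cutoff x r y * (C₁ * dist y z ^ β * m y) ≤ 1 * (C₁ * dist y z ^ β * m y) :=
          mul_le_mul_of_nonneg_right (cutoff_le_one x r y) (by have := hm0 y; positivity)
        have h4 : 0 ≤ dist y z ^ β * (R * v y) := by have := hv0 y; positivity
        have h5 : 0 ≤ dist y z ^ β * (C₁ * m z) := by have := hm0 z; positivity
        rw [hGy, hGz]
        simp only [hu]
        linarith
      · have h0 := cutoff_eq_zero hr hz
        have h2 := mul_le_mul_of_nonneg_right (hcut y z) (hv0 y)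
        have h4 : 0 ≤ dist y z ^ β * (C₁ * m y) := by have := hm0 y; positivity
        have h5 : 0 ≤ dist y z ^ β * G z := by have := hG0 z; positivity
        rw [hGy]
        simp only [hu]
        rw [h0] at h2 ⊢
        linarith
    · have h0 := cutoff_eq_zero hr hy
      have h1 : 0 ≤ cutoff x r z * v z := mul_nonneg (cutoff_nonneg _ _ _) (hv0 z)
      have h2 : 0 ≤ dist y z ^ β * (G y + G z) := mul_nonneg hd (add_nonneg (hG0 y) (hG0 z))
      simp only [hu]
      rw [h0]
      linarith
  have huabs : ∀ y z, |u y - u z| ≤ dist y z ^ β * (G y + G z) := fun y z =>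
    abs_sub_le_iff.2 ⟨huosc y z, by rw [dist_comm, add_comm]; exact huosc z y⟩
  have huhol : IsHolderFun β u := by
    set G₀ := 2 * (C₁ * (K * ENNReal.ofReal c).toReal + R * V.toReal)
    have hG₀ : 0 ≤ G₀ := by positivity
    have hGle : ∀ y, G y ≤ G₀ := fun y => indicator_le' (fun y _ => by
      have := hmle y
      have := hvle y
      show 2 * (C₁ * m y + R * v y) ≤ 2 * (C₁ * (K * ENNReal.ofReal c).toReal + R * V.toReal)
      gcongr) (fun _ _ => hG₀) y
    refine ⟨G₀ + G₀, by positivity, fun y z => (huabs y z).trans ?_⟩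
    rw [mul_comm]
    gcongr
    · exact hGle y
    · exact hGle z
  have hgrad : IsHajlaszGradient μ β u fun y => ENNReal.ofReal (G y) := by
    refine ⟨?_, ∅, measure_empty, fun y z _ _ => ?_⟩
    · have h1 : Measurable m := (measurable_maximalFunction μ Q f).ennreal_toReal
      have h2 : Measurable v := (hvhol.continuous hβ0).measurable
      exact (Measurable.indicator (by fun_prop) measurableSet_ball).ennreal_ofReal.aemeasurable
    · rw [← ENNReal.ofReal_add (hG0 y) (hG0 z), ← ENNReal.ofReal_mul (by positivity)]
      exact ENNReal.ofReal_le_ofReal (huabs y z)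
  have hcap : hajlaszCapacity μ β p F (ball x (2 * r)) ≤ ∫⁻ y, ENNReal.ofReal (G y) ^ p ∂μ := by
    refine iInf₂_le_of_le u huhol (iInf₂_le_of_le ?_ ?_ (iInf₂_le _ hgrad))
    · intro y hy
      have h1 : (2 : ℝ)⁻¹ ≤ v y := by
        have := ENNReal.toReal_mono (hPfin y) (hF y hy).le
        simpa using this
      simp only [hu]
      rw [cutoff_eq_one hr (hFr hy)]
      linarith
    · intro y hy
      simp only [hu]
      rw [cutoff_eq_zero hr hy]
      ring
  refine hcap.trans ?_
  set D₁ := ENNReal.ofReal (2 * C₁ + 2 * C₂)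
  -- The power of `r` is `r ^ (-β) * r ^ (β - Q/p)`; its `p`-th power cancels the mass `O(r ^ Q)` of
  -- the ball.
  set D₂ := ENNReal.ofReal (2 * C₂ * r ^ (-(Q / p)))
  have hpt : ∀ y, ENNReal.ofReal (G y) ^ p ≤
      (ball x (2 * r)).indicator (fun y => 2 ^ (p - 1) * ((D₁ * M y) ^ p + (D₂ * N) ^ p)) y := by
    intro y
    by_cases hy : y ∈ ball x (2 * r)
    · rw [indicator_of_mem hy, hG, indicator_of_mem hy]
      refine le_trans ?_ (ENNReal.rpow_add_le_mul_rpow_add_rpow _ _ hp.le)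
      gcongr
      have hPy := hhed f hf y r hr
      calc ENNReal.ofReal (2 * (C₁ * m y + R * v y))
          = ENNReal.ofReal (2 * C₁) * M y + ENNReal.ofReal (2 * R) * P y := by
            have := hm0 y
            have := hv0 y
            rw [← ENNReal.ofReal_toReal (hMfin y), ← ENNReal.ofReal_toReal (hPfin y),
              ← ENNReal.ofReal_mul (by positivity), ← ENNReal.ofReal_mul (by positivity),
              ← ENNReal.ofReal_add (by positivity) (by positivity)]
            congr 1
            simp only [hm, hv]
            ring
        _ ≤ ENNReal.ofReal (2 * C₁) * M y + ENNReal.ofReal (2 * R) *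
            (ENNReal.ofReal (C₂ * r ^ β) * M y + ENNReal.ofReal (C₂ * r ^ (β - Q / p)) * N) := by
            gcongr
        _ = D₁ * M y + D₂ * N := by
            rw [mul_add, ← mul_assoc, ← mul_assoc, ← add_assoc, ← add_mul,
              ← ENNReal.ofReal_mul (by positivity), ← ENNReal.ofReal_mul (by positivity),
              ← ENNReal.ofReal_add (by positivity) (by positivity)]
            have h1 : R * r ^ β = 1 := by
              rw [hR, ← Real.rpow_add hr, neg_add_cancel, Real.rpow_zero]
            have h2 : R * r ^ (β - Q / p) = r ^ (-(Q / p)) := by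
              rw [hR, ← Real.rpow_add hr]
              congr 1
              ring
            congr 3
            · linear_combination 2 * C₂ * h1
            · linear_combination 2 * C₂ * h2
    · rw [indicator_of_notMem hy, hG, indicator_of_notMem hy, ENNReal.ofReal_zero,
        ENNReal.zero_rpow_of_pos hp0]
  have hNp : N ^ p = ∫⁻ x, f x ^ p ∂μ := by
    rw [hN, ← ENNReal.rpow_mul, one_div_mul_cancel hp0.ne', ENNReal.rpow_one]
  set I := ∫⁻ x, f x ^ p ∂μ
  have hMp : Measurable fun y => (D₁ * M y) ^ p :=
    ((measurable_maximalFunction μ Q f).const_mul _).pow_const _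
  have hD₁ : D₁ ^ p = ENNReal.ofReal ((2 * C₁ + 2 * C₂) ^ p) :=
    ENNReal.ofReal_rpow_of_nonneg (by positivity) hp0.le
  calc ∫⁻ y, ENNReal.ofReal (G y) ^ p ∂μ
      ≤ ∫⁻ y in ball x (2 * r), 2 ^ (p - 1) * ((D₁ * M y) ^ p + (D₂ * N) ^ p) ∂μ := by
        rw [← lintegral_indicator measurableSet_ball]
        exact lintegral_mono hpt
    _ = 2 ^ (p - 1) * (D₁ ^ p * (∫⁻ y in ball x (2 * r), M y ^ p ∂μ) +
          D₂ ^ p * I * μ (ball x (2 * r))) := by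
        rw [lintegral_const_mul' _ _ (ENNReal.rpow_ne_top_of_nonneg (by linarith) (by simp)),
          lintegral_add_left hMp, setLIntegral_const, ENNReal.mul_rpow_of_nonneg _ _ hp0.le, hNp]
        simp only [ENNReal.mul_rpow_of_nonneg _ _ hp0.le]
        rw [lintegral_const_mul' _ _ (by rw [hD₁]; exact ENNReal.ofReal_ne_top)]
    _ ≤ 2 ^ (p - 1) * (D₁ ^ p * (ENNReal.ofReal C₃ * I) +
          D₂ ^ p * I * ENNReal.ofReal (c * (2 * r) ^ Q)) := by
        gcongr
        · exact (setLIntegral_le_lintegral _ _).trans (hmax f K hf hK hfK)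
        · exact hup x _ (by linarith)
    _ = _ := by
        have h2 : (2 : ℝ≥0∞) ^ (p - 1) = ENNReal.ofReal (2 ^ (p - 1)) := by
          rw [← ENNReal.ofReal_rpow_of_nonneg (by norm_num) (by linarith)]
          norm_num
        have hD₂ : D₂ ^ p = ENNReal.ofReal ((2 * C₂) ^ p * (r ^ Q)⁻¹) := by
          rw [ENNReal.ofReal_rpow_of_nonneg (by positivity) hp0.le,
            Real.mul_rpow (by positivity) (by positivity), ← Real.rpow_mul hr.le,
            ← Real.rpow_neg hr.le]
          congr 3
          field_simp
        rw [hD₁, hD₂, h2, ← mul_assoc (ENNReal.ofReal ((2 * C₁ + 2 * C₂) ^ p)), mul_right_comm _ I,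
          ← add_mul, ← mul_assoc, ← ENNReal.ofReal_mul (by positivity),
          ← ENNReal.ofReal_mul (by positivity), ← ENNReal.ofReal_add (by positivity) (by positivity),
          ← ENNReal.ofReal_mul (by positivity)]
        congr 4
        rw [Real.mul_rpow (by norm_num) hr.le]
        field_simp

/-- The Hajłasz capacity of a compact set in a ball is controlled by its Riesz capacity. -/
theorem exists_hajlaszCapacity_le_rieszCapacityOfDim [OpensMeasurableSpace X]
    [SecondCountableTopology X] {μ : Measure X} {c Q β p : ℝ} (hc : 0 < c) (hβ0 : 0 < β)
    (hβ1 : β < 1) (hp : 1 < p) (hβQ : β * p < Q) (hμ : ∀ x : X, μ {x} = 0)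
    (hup : ∀ (x : X) (t : ℝ), 0 < t → μ (ball x t) ≤ ENNReal.ofReal (c * t ^ Q)) :
    ∃ C : ℝ, 0 < C ∧ ∀ (F : Set X) (x : X) (r : ℝ), 0 < r → IsCompact F → F ⊆ closedBall x r →
      hajlaszCapacity μ β p F (ball x (2 * r)) ≤
        ENNReal.ofReal C * rieszCapacityOfDim μ Q β p F := by
  have hp0 : 0 < p := by linarith
  obtain ⟨C, hC, h⟩ := exists_hajlaszCapacity_le_of_bounded hc hβ0 hβ1 hp hβQ hμ hup
  refine ⟨C, hC, fun F x r hr hFc hFr => ?_⟩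
  have hC0 : ENNReal.ofReal C ≠ 0 := by simpa using hC
  rw [← ENNReal.div_le_iff' hC0 ENNReal.ofReal_ne_top]
  refine le_iInf₂ fun f₀ hf₀ => le_iInf fun hF₀ => ?_
  rw [ENNReal.div_le_iff' hC0 ENNReal.ofReal_ne_top]
  set f := hf₀.mk f₀ with hfdef
  have hf : Measurable f := hf₀.measurable_mk
  have hF : ∀ y ∈ F, 1 ≤ rieszPotentialOfDim μ Q β f y := fun y hy => by
    refine (hF₀ y hy).trans_eq (lintegral_congr_ae ?_)
    filter_upwards [hf₀.ae_eq_mk] with z hz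
    rw [hz]
  have hI : ∫⁻ z, f₀ z ^ p ∂μ = ∫⁻ z, f z ^ p ∂μ := by
    refine lintegral_congr_ae ?_
    filter_upwards [hf₀.ae_eq_mk] with z hz
    rw [hz]
  rw [hI]
  -- Truncating height and support makes each potential Hölder, with finite `L ^ p` energy.
  let g : ℕ → X → ℝ≥0∞ := fun n => (ball x n).indicator fun z => min (f z) n
  have hgm : ∀ n, Measurable (g n) := fun n =>
    (hf.min measurable_const).indicator measurableSet_ball
  have hgmono : Monotone g := by
    intro n k hnk z
    have hnk' : (n : ℝ) ≤ k := by exact_mod_cast hnk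
    by_cases hz : z ∈ ball x n
    · have hz' : z ∈ ball x k := ball_subset_ball hnk' hz
      simp only [g, indicator_of_mem hz, indicator_of_mem hz']
      exact min_le_min_left _ (by exact_mod_cast hnk)
    · simp only [g, indicator_of_notMem hz]
      exact zero_le
  have hgn : ∀ n z, g n z ≤ n := fun n z =>
    indicator_le' (fun _ _ => min_le_right _ _) (fun _ _ => zero_le) z
  have hgf : ∀ n z, g n z ≤ f z := fun n z =>
    indicator_le' (fun _ _ => min_le_left _ _) (fun _ _ => zero_le) z
  have hsup : ∀ z, ⨆ n, g n z = f z := by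
    intro z
    refine le_antisymm (iSup_le fun n => hgf n z) (le_of_forall_lt fun a ha => ?_)
    obtain ⟨n₁, hn₁⟩ := ENNReal.exists_nat_gt (ne_top_of_lt ha)
    obtain ⟨n₂, hn₂⟩ := exists_nat_gt (dist z x)
    refine lt_iSup_iff.2 ⟨max n₁ n₂, ?_⟩
    have hz : z ∈ ball x ((max n₁ n₂ : ℕ) : ℝ) :=
      hn₂.trans_le (by exact_mod_cast le_max_right n₁ n₂)
    simp only [g, indicator_of_mem hz]
    exact lt_min ha (hn₁.trans_le (by exact_mod_cast le_max_left n₁ n₂))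
  have hpsup : ∀ y, ⨆ n, rieszPotentialOfDim μ Q β (g n) y = rieszPotentialOfDim μ Q β f y := by
    intro y
    have hdist : Measurable fun z => dist y z :=
      (by fun_prop : Continuous fun z => dist y z).measurable
    unfold rieszPotentialOfDim
    refine (lintegral_iSup (f := fun n z => g n z / ENNReal.ofReal (dist y z ^ (Q - β)))
      (fun n => by have := hgm n; fun_prop)
      (fun n k hnk z => ENNReal.div_le_div_right (hgmono hnk z) _)).symm.trans ?_
    refine lintegral_congr fun z => ?_
    rw [← hsup z, ENNReal.iSup_div]
  have hgp : ∀ n, ∫⁻ z, g n z ^ p ∂μ ≠ ∞ := by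
    intro n
    have h1 : ∀ z, g n z ^ p ≤ (ball x (n + 1)).indicator (fun _ => (n : ℝ≥0∞) ^ p) z := by
      intro z
      by_cases hz : z ∈ ball x n
      · rw [indicator_of_mem (ball_subset_ball (by linarith) hz)]
        gcongr
        exact hgn n z
      · simp only [g, indicator_of_notMem hz, ENNReal.zero_rpow_of_pos hp0]
        exact zero_le
    refine ne_top_of_le_ne_top ?_ (lintegral_mono h1)
    rw [lintegral_indicator measurableSet_ball, setLIntegral_const]
    exact ENNReal.mul_ne_top (ENNReal.rpow_ne_top_of_nonneg hp0.le (ENNReal.natCast_ne_top n))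
      (ne_top_of_le_ne_top ENNReal.ofReal_ne_top (hup x _ (by positivity)))
  have hbd := fun n => h (g n) n (hgm n) (ENNReal.natCast_ne_top n) (hgn n) (hgp n)
  let U : ℕ → Set X := fun n => {y | (2 : ℝ)⁻¹ < (rieszPotentialOfDim μ Q β (g n) y).toReal}
  have hUiff : ∀ n y, y ∈ U n ↔ 2⁻¹ < rieszPotentialOfDim μ Q β (g n) y := by
    intro n y
    have := ENNReal.ofReal_lt_iff_lt_toReal (a := 2⁻¹) (by norm_num) ((hbd n).2.1 y)
    rw [ENNReal.ofReal_inv_of_pos (by norm_num), ENNReal.ofReal_ofNat] at this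
    exact this.symm
  have hUmono : Monotone U := fun n k hnk y hy => (hUiff k y).2 (((hUiff n y).1 hy).trans_le
    (lintegral_mono fun z => ENNReal.div_le_div_right (hgmono hnk z) _))
  -- The potentials increase to a limit at least 1 on `F`, so the open sets where they exceed `1/2`
  -- increase and cover the compact set `F`; one of them contains it.
  obtain ⟨n, hn⟩ := hFc.elim_directed_cover U
    (fun n => isOpen_lt continuous_const ((hbd n).1.continuous hβ0))
    (fun y hy => by
      have h1 : (2 : ℝ≥0∞)⁻¹ < ⨆ n, rieszPotentialOfDim μ Q β (g n) y := by
        rw [hpsup]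
        exact lt_of_lt_of_le (by simp) (hF y hy)
      obtain ⟨n, hn⟩ := lt_iSup_iff.1 h1
      exact mem_iUnion.2 ⟨n, (hUiff n y).2 hn⟩)
    hUmono.directed_le
  refine ((hbd n).2.2 F x r hr hFr fun y hy => (hUiff n y).1 (hn hy)).trans ?_
  gcongr with z
  exact hgf n z

end CapacityUpperBound

/-! ### Dyadic sums, one link of a chain, and points at a given distance -/

section MetricLemmas

open Metric Set

/-- A truncated geometric sum over the dyadic scales larger than `d`. -/
theorem tsum_dyadic_rpow_neg_le {R s : ℝ} (hR : 0 < R) (hs : 0 < s) {d : ℝ} (hd : 0 < d) :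
    ∑' k : ℕ, (if d < R * 2⁻¹ ^ k then ENNReal.ofReal ((R * 2⁻¹ ^ k) ^ (-s)) else 0) ≤
      ENNReal.ofReal ((1 - 2 ^ (-s))⁻¹ * d ^ (-s)) := by
  set b : ℝ := 2 ^ (-s) with hb
  have hb0 : 0 < b := by positivity
  have hb1 : b < 1 := Real.rpow_lt_one_of_one_lt_of_neg (by norm_num) (by linarith)
  have hC : (0 : ℝ) < (1 - b)⁻¹ := inv_pos.2 (by linarith)
  have hCb : (1 - b)⁻¹ * b + 1 = (1 - b)⁻¹ := by
    have : 1 - b ≠ 0 := by linarith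
    field_simp
    ring
  set T : ℕ → ℝ := fun k => (R * 2⁻¹ ^ k) ^ (-s) with hT
  have hτ : ∀ k : ℕ, 0 < R * 2⁻¹ ^ k := fun k => by positivity
  have hT0 : ∀ k, 0 ≤ T k := fun k => by have := hτ k; positivity
  have hTsucc : ∀ k, b * T (k + 1) = T k := by
    intro k
    simp only [hT, hb]
    rw [← Real.mul_rpow (by norm_num) (hτ _).le]
    congr 1
    rw [pow_succ]
    ring
  -- The second bound drives the induction: `T` grows by the factor `b⁻¹`, so all terms before `n`
  -- sum to at most `b / (1 - b)` times `T n`. The first follows from it as long as `d` is below the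
  -- scale, and afterwards no term is added.
  have hsum : ∀ n : ℕ, (∑ k ∈ Finset.range n, if d < R * 2⁻¹ ^ k then T k else 0) ≤
      (1 - b)⁻¹ * d ^ (-s) ∧
      (∑ k ∈ Finset.range n, if d < R * 2⁻¹ ^ k then T k else 0) ≤ (1 - b)⁻¹ * (b * T n) := by
    intro n
    induction n with
    | zero =>
      have := hT0 0
      simp only [Finset.range_zero, Finset.sum_empty]
      constructor <;> positivity
    | succ n ih =>
      rw [Finset.sum_range_succ, hTsucc]
      by_cases h : d < R * 2⁻¹ ^ n
      · rw [if_pos h]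
        have h1 : T n ≤ d ^ (-s) := Real.rpow_le_rpow_of_nonpos hd h.le (by linarith)
        have h2 := mul_le_mul_of_nonneg_left h1 hC.le
        have h3 : (1 - b)⁻¹ * (b * T n) + T n = (1 - b)⁻¹ * T n := by
          linear_combination (T n) * hCb
        constructor <;> linarith [ih.2]
      · rw [if_neg h, add_zero]
        have h1 : d ^ (-s) ≤ T n :=
          Real.rpow_le_rpow_of_nonpos (hτ n) (not_lt.1 h) (by linarith)
        have h2 := mul_le_mul_of_nonneg_left h1 hC.le
        exact ⟨ih.1, ih.1.trans h2⟩
  refine ENNReal.tsum_le_of_sum_range_le fun n => ?_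
  have h0 : ∀ k, (if d < R * 2⁻¹ ^ k then ENNReal.ofReal (T k) else 0) =
      ENNReal.ofReal (if d < R * 2⁻¹ ^ k then T k else 0) := fun k => by
    split_ifs <;> simp
  simp only [hT] at h0 hsum hT0
  rw [Finset.sum_congr rfl fun k _ => h0 k, ← ENNReal.ofReal_sum_of_nonneg]
  · exact ENNReal.ofReal_le_ofReal (hsum n).1
  · intro k _
    split_ifs
    · exact hT0 k
    · exact le_rfl

variable {X : Type*}

theorem lintegral_ofReal_mul_rpow [MeasurableSpace X] {μ : Measure X} {a p : ℝ} (ha : 0 ≤ a)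
    (hp : 0 ≤ p) (f : X → ℝ≥0∞) :
    ∫⁻ x, (ENNReal.ofReal a * f x) ^ p ∂μ = ENNReal.ofReal (a ^ p) * ∫⁻ x, f x ^ p ∂μ := by
  rw [← lintegral_const_mul' _ _ ENNReal.ofReal_ne_top]
  exact lintegral_congr fun x => by
    rw [ENNReal.mul_rpow_of_nonneg _ _ hp, ENNReal.ofReal_rpow_of_nonneg ha hp]

variable [MetricSpace X]

/-- One link of the chain: `d(w,w') ≤ 2t`, and both gradient values are `O(L / t ^ Q)`. The ratio 6
accommodates both the dyadic links and the first link, from `B(y, 6r)` to `B(z, r)`. -/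
theorem edist_le_of_gradient_le {β Q b : ℝ} (hβ : 0 < β) (hQ : 0 < Q) (hb : 0 < b) {u : X → ℝ}
    {g : X → ℝ≥0∞} {y w w' : X} {t t' : ℝ} (ht' : 0 < t') (htt' : t ≤ 6 * t') (hw : w ∈ ball y t)
    (hw' : w' ∈ ball y t) {L : ℝ≥0∞}
    (huw : ENNReal.ofReal |u w - u w'| ≤ ENNReal.ofReal (dist w w' ^ β) * (g w + g w'))
    (hg : g w ≤ L / ENNReal.ofReal (b * t ^ Q)) (hg' : g w' ≤ L / ENNReal.ofReal (b * t' ^ Q)) :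
    edist (u w) (u w') ≤
      ENNReal.ofReal (2 ^ β / b * (1 + 6 ^ Q)) * (ENNReal.ofReal (t ^ (-(Q - β))) * L) := by
  have ht : 0 < t := pos_of_mem_ball hw
  have hd : dist w w' ≤ 2 * t := by
    have h1 : dist w y < t := hw
    have h2 : dist w' y < t := hw'
    linarith [dist_triangle_right w w' y]
  have hg'' : g w' ≤ ENNReal.ofReal (6 ^ Q) * (L / ENNReal.ofReal (b * t ^ Q)) := by
    refine hg'.trans ?_
    rw [div_eq_mul_inv, div_eq_mul_inv, mul_left_comm, ← ENNReal.ofReal_inv_of_pos (by positivity),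
      ← ENNReal.ofReal_inv_of_pos (by positivity), ← ENNReal.ofReal_mul (by positivity)]
    gcongr
    have h1 : t ^ Q ≤ 6 ^ Q * t' ^ Q := by
      rw [← Real.mul_rpow (by norm_num) ht'.le]
      exact Real.rpow_le_rpow ht.le htt' hQ.le
    rw [← div_eq_mul_inv, inv_eq_one_div, div_le_div_iff₀ (by positivity) (by positivity)]
    nlinarith
  rw [edist_dist, Real.dist_eq]
  calc ENNReal.ofReal |u w - u w'| ≤ ENNReal.ofReal (dist w w' ^ β) * (g w + g w') := huw
    _ ≤ ENNReal.ofReal ((2 * t) ^ β) * (L / ENNReal.ofReal (b * t ^ Q) +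
          ENNReal.ofReal (6 ^ Q) * (L / ENNReal.ofReal (b * t ^ Q))) := by gcongr
    _ = _ := by
      rw [div_eq_mul_inv, ← ENNReal.ofReal_inv_of_pos (by positivity), ← one_add_mul,
        ← ENNReal.ofReal_one, ← ENNReal.ofReal_add (by norm_num) (by positivity), mul_comm L,
        ← mul_assoc, ← mul_assoc, ← mul_assoc, ← ENNReal.ofReal_mul (by positivity),
        ← ENNReal.ofReal_mul (by positivity), ← ENNReal.ofReal_mul (by positivity)]
      congr 2
      rw [neg_sub, Real.rpow_sub ht, Real.mul_rpow (by norm_num) ht.le]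
      field_simp

/-- Intermediate values of the distance to `x`: if all distances were below `r`, the diameter would
be at most `2r`. -/
theorem exists_dist_eq_of_lt_ediam [ConnectedSpace X] {r : ℝ} (hr : 0 ≤ r)
    (h : ENNReal.ofReal (2 * r) < ediam (univ : Set X)) (x : X) : ∃ z : X, dist z x = r := by
  refine mem_range_of_exists_le_of_exists_ge (f := fun z => dist z x) (by fun_prop)
    ⟨x, by simpa using hr⟩ ?_
  by_contra! hcon
  refine absurd h (not_lt.2 (ediam_le fun y _ z _ => ?_))
  rw [edist_dist]
  refine ENNReal.ofReal_le_ofReal ?_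
  linarith [dist_triangle_right y z x, hcon y, hcon z]

end MetricLemmas

/-! ### Riesz capacity bounded by Hajłasz capacity -/

section CapacityLowerBound

open Metric Set Filter Topology

variable {X : Type*} [MetricSpace X] [MeasurableSpace X]

/-- A function is at most its mean on a set of positive measure, which cannot be contained in a null
set. -/
theorem exists_mem_ball_le_div {μ : Measure X} {g : X → ℝ≥0∞} (hg : AEMeasurable g μ) {N : Set X}
    (hN : μ N = 0) {z : X} {t : ℝ} (hfin : μ (ball z t) < ∞) {a : ℝ} (ha : 0 < a)
    (hlow : ENNReal.ofReal a ≤ μ (ball z t)) :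
    ∃ w ∈ ball z t, w ∉ N ∧ g w ≤ (∫⁻ x in ball z t, g x ∂μ) / ENNReal.ofReal a := by
  have hpos : μ (ball z t) ≠ 0 := ((ENNReal.ofReal_pos.2 ha).trans_le hlow).ne'
  have h := measure_le_setLAverage_pos hpos hfin.ne hg.restrict
  rw [← measure_sdiff_null hN] at h
  obtain ⟨w, ⟨hw, hle⟩, hwN⟩ := nonempty_of_measure_ne_zero h.ne'
  refine ⟨w, hw, hwN, hle.trans ?_⟩
  rw [setLAverage_eq]
  gcongr

/-- A Hölder function with Hajłasz gradient `g` which vanishes on a ball comparable to `B(y, R)` is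
controlled at `y` by the Riesz potential of `g`. -/
theorem exists_ofReal_le_rieszPotentialOfDim [OpensMeasurableSpace X] {μ : Measure X} {Q β b : ℝ}
    (hβ : 0 < β) (hβQ : β < Q) (hb : 0 < b) (hμ : ∀ x : X, μ {x} = 0)
    (hfin : ∀ (x : X) (t : ℝ), 0 < t → μ (ball x t) < ∞)
    (hlow : ∀ (x : X) (t : ℝ), 0 < t → ENNReal.ofReal t < ediam (univ : Set X) →
      ENNReal.ofReal (b * t ^ Q) ≤ μ (ball x t)) :
    ∃ C : ℝ, 0 < C ∧ ∀ (u : X → ℝ) (g : X → ℝ≥0∞), IsHolderFun β u → IsHajlaszGradient μ β u g →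
      ∀ (y z : X) (r : ℝ), 0 < r → ENNReal.ofReal (6 * r) < ediam (univ : Set X) →
        ball z r ⊆ ball y (6 * r) → (∀ w ∈ ball z r, u w = 0) →
        ENNReal.ofReal (u y) ≤ ENNReal.ofReal C * rieszPotentialOfDim μ Q β g y := by
  have hQ : 0 < Q := by linarith
  have hs : 0 < Q - β := by linarith
  have hq1 : (2 : ℝ) ^ (-(Q - β)) < 1 :=
    Real.rpow_lt_one_of_one_lt_of_neg (by norm_num) (by linarith)
  set q : ℝ := (1 - 2 ^ (-(Q - β)))⁻¹ with hq
  have hq0 : 0 < q := inv_pos.2 (by linarith)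
  set D : ℝ := 2 ^ β / b * (1 + 6 ^ Q) with hD
  have hD0 : 0 < D := by positivity
  refine ⟨2 * D * q, by positivity, fun u g hu hgrad y z r hr hr6 hzy hz => ?_⟩
  obtain ⟨hgm, N, hN, hug⟩ := hgrad
  set τ : ℕ → ℝ := fun k => 6 * r * 2⁻¹ ^ k with hτdef
  have hτ : ∀ k, 0 < τ k := fun k => by simp only [hτdef]; positivity
  have hτle : ∀ k, τ k ≤ 6 * r := fun k =>
    mul_le_of_le_one_right (by positivity) (pow_le_one₀ (by norm_num) (by norm_num))
  have hτsucc : ∀ k, τ k = 2 * τ (k + 1) := fun k => by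
    simp only [hτdef, pow_succ]
    ring
  have hlt : ∀ t, t ≤ 6 * r → ENNReal.ofReal t < ediam (univ : Set X) := fun t ht =>
    (ENNReal.ofReal_le_ofReal ht).trans_lt hr6
  have hchoose : ∀ (x : X) (t : ℝ), 0 < t → t ≤ 6 * r → ∃ w ∈ ball x t, w ∉ N ∧
      g w ≤ (∫⁻ a in ball x t, g a ∂μ) / ENNReal.ofReal (b * t ^ Q) := fun x t ht ht6 =>
    exists_mem_ball_le_div hgm hN (hfin x t ht) (by positivity) (hlow x t ht (hlt t ht6))
  choose w hwb hwN hwg using fun k => hchoose y (τ k) (hτ k) (hτle k)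
  obtain ⟨w', hwb', hwN', hwg'⟩ := hchoose z r hr (by linarith)
  set J : ℕ → ℝ≥0∞ := fun k =>
    ENNReal.ofReal (τ k ^ (-(Q - β))) * ∫⁻ a in ball y (τ k), g a ∂μ with hJ
  have hτ0 : τ 0 = 6 * r := by simp [hτdef]
  have hstep : ∀ k, edist (u (w k)) (u (w (k + 1))) ≤ ENNReal.ofReal D * J k := by
    intro k
    have hτk := hτsucc k
    have hτk' := hτ (k + 1)
    have hsub : ball y (τ (k + 1)) ⊆ ball y (τ k) := ball_subset_ball (by linarith)
    refine edist_le_of_gradient_le hβ hQ hb hτk' (by linarith) (hwb k) (hsub (hwb (k + 1)))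
      (hug _ _ (hwN k) (hwN (k + 1))) (hwg k) ((hwg (k + 1)).trans ?_)
    gcongr
  have hfirst : edist (u (w 0)) (u w') ≤ ENNReal.ofReal D * J 0 := by
    refine edist_le_of_gradient_le hβ hQ hb hr hτ0.le (hwb 0) (by rw [hτ0]; exact hzy hwb')
      (hug _ _ (hwN 0) hwN') (hwg 0) (hwg'.trans ?_)
    rw [hτ0]
    gcongr
  have hlim : Tendsto w atTop (𝓝 y) := by
    refine tendsto_iff_dist_tendsto_zero.2 (squeeze_zero (fun _ => dist_nonneg)
      (fun k => (mem_ball.1 (hwb k)).le) ?_)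
    have := (tendsto_pow_atTop_nhds_zero_of_lt_one (r := (2⁻¹ : ℝ)) (by norm_num)
      (by norm_num)).const_mul (6 * r)
    simpa [hτdef] using this
  -- Continuity of `u` at `y` closes the chain, so `y` itself may lie in the exceptional set `N`.
  have hchain : edist (u (w 0)) (u y) ≤ ∑' k, ENNReal.ofReal D * J k :=
    edist_le_tsum_of_edist_le_of_tendsto₀ _ hstep ((hu.continuous hβ).tendsto y |>.comp hlim)
  -- By Tonelli the scales are summed first at each point `a`; only those above `d(y,a)` count, and
  -- they form a geometric sum comparable to the kernel.
  have hJsum : ∑' k, J k ≤ ENNReal.ofReal q * rieszPotentialOfDim μ Q β g y := by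
    have h1 : ∀ k, J k = ∫⁻ a, (ball y (τ k)).indicator
        (fun a => ENNReal.ofReal (τ k ^ (-(Q - β))) * g a) a ∂μ := fun k => by
      rw [lintegral_indicator measurableSet_ball, lintegral_const_mul' _ _ ENNReal.ofReal_ne_top]
    simp only [h1]
    rw [← lintegral_tsum fun k => (hgm.const_mul _).indicator measurableSet_ball,
      rieszPotentialOfDim, ← lintegral_const_mul' _ _ ENNReal.ofReal_ne_top]
    refine lintegral_mono_ae ?_
    filter_upwards [measure_eq_zero_iff_ae_notMem.1 (hμ y)] with a ha
    have hd : 0 < dist y a := dist_pos.2 fun h => ha h.symm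
    have h2 : ∀ k, (ball y (τ k)).indicator
        (fun a => ENNReal.ofReal (τ k ^ (-(Q - β))) * g a) a =
        (if dist y a < 6 * r * 2⁻¹ ^ k then
          ENNReal.ofReal ((6 * r * 2⁻¹ ^ k) ^ (-(Q - β))) else 0) * g a := fun k => by
      rw [ite_mul, zero_mul]
      by_cases h : a ∈ ball y (τ k)
      · rw [indicator_of_mem h, if_pos (mem_ball'.1 h)]
      · rw [indicator_of_notMem h, if_neg fun h' => h (mem_ball'.2 h')]
    simp only [h2]
    rw [ENNReal.tsum_mul_right, mul_comm (ENNReal.ofReal q), mul_comm _ (g a), div_eq_mul_inv,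
      mul_assoc]
    gcongr
    refine (tsum_dyadic_rpow_neg_le (by positivity) hs hd).trans_eq ?_
    rw [← ENNReal.ofReal_inv_of_pos (by positivity), ← ENNReal.ofReal_mul (by positivity),
      Real.rpow_neg hd.le, mul_comm]
  calc ENNReal.ofReal (u y) ≤ edist (u w') (u y) := by
        rw [hz w' hwb', edist_dist, Real.dist_eq]
        refine ENNReal.ofReal_le_ofReal ?_
        rw [zero_sub, abs_neg]
        exact le_abs_self _
    _ ≤ edist (u (w 0)) (u w') + edist (u (w 0)) (u y) := edist_triangle_left _ _ _
    _ ≤ ENNReal.ofReal D * J 0 + ENNReal.ofReal D * ∑' k, J k := by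
        rw [← ENNReal.tsum_mul_left]
        exact add_le_add hfirst hchain
    _ ≤ ENNReal.ofReal D * ∑' k, J k + ENNReal.ofReal D * ∑' k, J k := by
        gcongr
        exact ENNReal.le_tsum 0
    _ ≤ ENNReal.ofReal (2 * D) * (ENNReal.ofReal q * rieszPotentialOfDim μ Q β g y) := by
        rw [← two_mul, ENNReal.ofReal_mul (p := 2) (by norm_num), ENNReal.ofReal_ofNat, mul_assoc]
        gcongr
    _ = _ := by rw [← mul_assoc, ← ENNReal.ofReal_mul (by positivity)]

theorem rieszPotential_const_mul (μ : Measure X) (β : ℝ) {a : ℝ≥0∞} (ha : a ≠ ∞)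
    (f : X → ℝ≥0∞) (x : X) :
    rieszPotential μ β (fun z => a * f z) x = a * rieszPotential μ β f x := by
  unfold rieszPotential
  rw [← lintegral_const_mul' _ _ ha]
  exact lintegral_congr fun z => by rw [mul_assoc, mul_div_assoc]

theorem rieszPotentialOfDim_const_mul (μ : Measure X) (Q β : ℝ) {a : ℝ≥0∞} (ha : a ≠ ∞)
    (f : X → ℝ≥0∞) (x : X) :
    rieszPotentialOfDim μ Q β (fun z => a * f z) x = a * rieszPotentialOfDim μ Q β f x := by
  unfold rieszPotentialOfDim
  rw [← lintegral_const_mul' _ _ ha]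
  exact lintegral_congr fun z => by rw [mul_div_assoc]

theorem rieszCapacityOfDim_le {μ : Measure X} {Q β p a : ℝ} (ha : 0 ≤ a) (hp : 0 ≤ p) {F : Set X}
    {f : X → ℝ≥0∞} (hf : AEMeasurable f μ)
    (h : ∀ x ∈ F, 1 ≤ ENNReal.ofReal a * rieszPotentialOfDim μ Q β f x) :
    rieszCapacityOfDim μ Q β p F ≤ ENNReal.ofReal (a ^ p) * ∫⁻ x, f x ^ p ∂μ := by
  refine iInf₂_le_of_le (fun x => ENNReal.ofReal a * f x) (hf.const_mul _)
    (iInf_le_of_le (fun x hx => ?_) (lintegral_ofReal_mul_rpow ha hp f).le)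
  rw [rieszPotentialOfDim_const_mul _ _ _ ENNReal.ofReal_ne_top]
  exact h x hx

theorem rieszCapacity_le {μ : Measure X} {β p a : ℝ} (ha : 0 ≤ a) (hp : 0 ≤ p) {F : Set X}
    {f : X → ℝ≥0∞} (hf : AEMeasurable f μ)
    (h : ∀ x ∈ F, 1 ≤ ENNReal.ofReal a * rieszPotential μ β f x) :
    rieszCapacity μ β p F ≤ ENNReal.ofReal (a ^ p) * ∫⁻ x, f x ^ p ∂μ := by
  refine iInf₂_le_of_le (fun x => ENNReal.ofReal a * f x) (hf.const_mul _)
    (iInf_le_of_le (fun x hx => ?_) (lintegral_ofReal_mul_rpow ha hp f).le)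
  rw [rieszPotential_const_mul _ _ ENNReal.ofReal_ne_top]
  exact h x hx

/-- The Riesz capacity of a set in a ball is controlled by its Hajłasz capacity. -/
theorem exists_rieszCapacityOfDim_le_hajlaszCapacity [OpensMeasurableSpace X] [ConnectedSpace X]
    {μ : Measure X} {Q β p b : ℝ} (hβ : 0 < β) (hβQ : β < Q) (hp : 0 < p) (hb : 0 < b)
    (hμ : ∀ x : X, μ {x} = 0) (hfin : ∀ (x : X) (t : ℝ), 0 < t → μ (ball x t) < ∞)
    (hlow : ∀ (x : X) (t : ℝ), 0 < t → ENNReal.ofReal t < ediam (univ : Set X) →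
      ENNReal.ofReal (b * t ^ Q) ≤ μ (ball x t)) :
    ∃ C : ℝ, 0 < C ∧ ∀ (F : Set X) (x : X) (r : ℝ), 0 < r →
      ENNReal.ofReal (8 * r) < ediam (univ : Set X) → F ⊆ closedBall x r →
      rieszCapacityOfDim μ Q β p F ≤
        ENNReal.ofReal C * hajlaszCapacity μ β p F (ball x (2 * r)) := by
  obtain ⟨C, hC, h⟩ := exists_ofReal_le_rieszPotentialOfDim hβ hβQ hb hμ hfin hlow
  have hCp : 0 < C ^ p := by positivity
  have hC0 : ENNReal.ofReal (C ^ p) ≠ 0 := by simpa using hCp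
  refine ⟨C ^ p, hCp, fun F x r hr hr8 hF => ?_⟩
  have h6 : ENNReal.ofReal (6 * r) < ediam (univ : Set X) :=
    (ENNReal.ofReal_le_ofReal (by linarith)).trans_lt hr8
  -- At distance `3r`, the ball `B(z, r)` misses `B(x, 2r)`, so `u = 0` there; it lies in `B(y, 6r)`
  -- because `d(z,y) ≤ 4r`.
  obtain ⟨z, hz⟩ := exists_dist_eq_of_lt_ediam (r := 3 * r) (by positivity)
    (by rwa [show 2 * (3 * r) = 6 * r by ring]) x
  rw [← ENNReal.div_le_iff' hC0 ENNReal.ofReal_ne_top]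
  refine le_iInf₂ fun u hu => le_iInf₂ fun hu1 hu0 => le_iInf₂ fun g hg => ?_
  rw [ENNReal.div_le_iff' hC0 ENNReal.ofReal_ne_top]
  refine rieszCapacityOfDim_le hC.le hp.le hg.1 fun y hy => ?_
  have hyx : dist y x ≤ r := hF hy
  refine le_trans ?_ (h u g hu hg y z r hr h6 (ball_subset_ball' ?_) fun w hw => hu0 w ?_)
  · simpa using hu1 y hy
  · linarith [dist_triangle_right z y x]
  · intro hwx
    have h1 : dist w z < r := hw
    have h2 : dist w x < 2 * r := hwx
    linarith [dist_triangle_left z x w]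

end CapacityLowerBound

/-! ### Comparison of the two Riesz potentials -/

section Comparison

open Metric Set

variable {X : Type*} [MetricSpace X] [MeasurableSpace X]

theorem rieszPotential_le_rieszPotentialOfDim {μ : Measure X} {Q β b : ℝ} (hb : 0 < b)
    (hμ : ∀ x : X, μ {x} = 0)
    (hlow : ∀ (x : X) (t : ℝ), 0 < t → ENNReal.ofReal t < ediam (univ : Set X) →
      ENNReal.ofReal (b * t ^ Q) ≤ μ (ball x t)) (f : X → ℝ≥0∞) (x : X) :
    rieszPotential μ β f x ≤ ENNReal.ofReal (2 ^ Q / b) * rieszPotentialOfDim μ Q β f x := by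
  unfold rieszPotential rieszPotentialOfDim
  rw [← lintegral_const_mul' _ _ ENNReal.ofReal_ne_top]
  refine lintegral_mono_ae ?_
  filter_upwards [measure_eq_zero_iff_ae_notMem.1 (hμ x)] with z hz
  have hd : 0 < dist x z := dist_pos.2 fun h => hz h.symm
  -- Regularity only concerns radii strictly below the diameter, which `d(x,z)` may equal; halving
  -- the radius costs the factor `2 ^ Q`.
  have h1 : ENNReal.ofReal (b * (dist x z / 2) ^ Q) ≤ μ (ball x (dist x z)) := by
    refine (hlow x _ (half_pos hd) ?_).trans (measure_mono (ball_subset_ball (by linarith)))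
    refine ((ENNReal.ofReal_lt_ofReal_iff hd).2 (half_lt_self hd)).trans_le ?_
    rw [← edist_dist]
    exact edist_le_ediam_of_mem (mem_univ x) (mem_univ z)
  calc f z * ENNReal.ofReal (dist x z ^ β) / μ (ball x (dist x z))
      ≤ f z * ENNReal.ofReal (dist x z ^ β) / ENNReal.ofReal (b * (dist x z / 2) ^ Q) := by gcongr
    _ = _ := by
      rw [div_eq_mul_inv (f z * _), div_eq_mul_inv (f z), mul_left_comm, mul_assoc,
        ← ENNReal.ofReal_inv_of_pos (by positivity), ← ENNReal.ofReal_inv_of_pos (by positivity),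
        ← ENNReal.ofReal_mul (by positivity), ← ENNReal.ofReal_mul (by positivity)]
      congr 2
      rw [Real.div_rpow hd.le (by norm_num), Real.rpow_sub hd]
      field_simp

theorem rieszPotentialOfDim_le_rieszPotential {μ : Measure X} {Q β c : ℝ} (hc : 0 < c)
    (hμ : ∀ x : X, μ {x} = 0)
    (hup : ∀ (x : X) (t : ℝ), 0 < t → μ (ball x t) ≤ ENNReal.ofReal (c * t ^ Q))
    (f : X → ℝ≥0∞) (x : X) :
    rieszPotentialOfDim μ Q β f x ≤ ENNReal.ofReal c * rieszPotential μ β f x := by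
  unfold rieszPotential rieszPotentialOfDim
  rw [← lintegral_const_mul' _ _ ENNReal.ofReal_ne_top]
  refine lintegral_mono_ae ?_
  filter_upwards [measure_eq_zero_iff_ae_notMem.1 (hμ x)] with z hz
  have hd : 0 < dist x z := dist_pos.2 fun h => hz h.symm
  calc f z / ENNReal.ofReal (dist x z ^ (Q - β))
      = ENNReal.ofReal c *
          (f z * ENNReal.ofReal (dist x z ^ β) / ENNReal.ofReal (c * dist x z ^ Q)) := by
        rw [div_eq_mul_inv, div_eq_mul_inv, mul_assoc, mul_left_comm,
          ← ENNReal.ofReal_inv_of_pos (by positivity), ← ENNReal.ofReal_inv_of_pos (by positivity),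
          ← ENNReal.ofReal_mul (by positivity), ← ENNReal.ofReal_mul (by positivity)]
        congr 2
        rw [Real.rpow_sub hd]
        field_simp
    _ ≤ _ := by
        gcongr
        exact hup x _ hd

theorem rieszCapacityOfDim_le_rieszCapacity {μ : Measure X} {Q β p b : ℝ} (hb : 0 < b) (hp : 0 ≤ p)
    (hμ : ∀ x : X, μ {x} = 0)
    (hlow : ∀ (x : X) (t : ℝ), 0 < t → ENNReal.ofReal t < ediam (univ : Set X) →
      ENNReal.ofReal (b * t ^ Q) ≤ μ (ball x t)) (F : Set X) :
    rieszCapacityOfDim μ Q β p F ≤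
      ENNReal.ofReal ((2 ^ Q / b) ^ p) * rieszCapacity μ β p F := by
  have hD : 0 < (2 ^ Q / b) ^ p := by positivity
  have hD0 : ENNReal.ofReal ((2 ^ Q / b) ^ p) ≠ 0 := by simpa using hD
  rw [← ENNReal.div_le_iff' hD0 ENNReal.ofReal_ne_top]
  refine le_iInf₂ fun f hf => le_iInf fun hF => ?_
  rw [ENNReal.div_le_iff' hD0 ENNReal.ofReal_ne_top]
  exact rieszCapacityOfDim_le (by positivity) hp hf fun x hx =>
    (hF x hx).trans (rieszPotential_le_rieszPotentialOfDim hb hμ hlow f x)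

theorem rieszCapacity_le_rieszCapacityOfDim {μ : Measure X} {Q β p c : ℝ} (hc : 0 < c) (hp : 0 ≤ p)
    (hμ : ∀ x : X, μ {x} = 0)
    (hup : ∀ (x : X) (t : ℝ), 0 < t → μ (ball x t) ≤ ENNReal.ofReal (c * t ^ Q)) (F : Set X) :
    rieszCapacity μ β p F ≤ ENNReal.ofReal (c ^ p) * rieszCapacityOfDim μ Q β p F := by
  have hD : 0 < c ^ p := by positivity
  have hD0 : ENNReal.ofReal (c ^ p) ≠ 0 := by simpa using hD
  rw [← ENNReal.div_le_iff' hD0 ENNReal.ofReal_ne_top]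
  refine le_iInf₂ fun f hf => le_iInf fun hF => ?_
  rw [ENNReal.div_le_iff' hD0 ENNReal.ofReal_ne_top]
  exact rieszCapacity_le hc.le hp hf fun x hx =>
    (hF x hx).trans (rieszPotentialOfDim_le_rieszPotential hc hμ hup f x)

end Comparison

end MetricCapacity

end

/-! ### Assembly of the two-sided estimates -/

theorem ENNReal.ofReal_inv_mul_le_and_le {a b : ℝ≥0∞} {A B C : ℝ} (hC : 0 < C) (hA : A ≤ C)
    (hB : B ≤ C) (hab : a ≤ ENNReal.ofReal A * b) (hba : b ≤ ENNReal.ofReal B * a) :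
    ENNReal.ofReal C⁻¹ * a ≤ b ∧ b ≤ ENNReal.ofReal C * a := by
  refine ⟨?_, hba.trans (by gcongr)⟩
  calc ENNReal.ofReal C⁻¹ * a ≤ ENNReal.ofReal C⁻¹ * (ENNReal.ofReal C * b) := by
        gcongr
        exact hab.trans (by gcongr)
    _ = b := by
        rw [← mul_assoc, ← ENNReal.ofReal_mul (by positivity), inv_mul_cancel₀ hC.ne',
          ENNReal.ofReal_one, one_mul]

theorem mainTheorem4 {X : Type*} [MetricSpace X] [CompleteSpace X] [ConnectedSpace X]
    [MeasurableSpace X] [BorelSpace X] (μ : MeasureTheory.Measure X)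
    (hμ : ∀ (x : X) (r : ℝ), 0 < r → 0 < μ (Metric.ball x r) ∧ μ (Metric.ball x r) < ∞)
    (p β Q : ℝ) (hp : 1 < p) (hβ0 : 0 < β) (hβ1 : β < 1) (hQ0 : 0 < Q) (hQ : β * p < Q)
    (hreg : MetricCapacity.IsAhlforsRegular μ Q) :
    ∃ C : ℝ, 0 < C ∧ ∀ (E : Set X) (x : X) (r : ℝ), IsClosed E → x ∈ E → 0 < r →
      ENNReal.ofReal r < Metric.ediam (Set.univ : Set X) / 8 →
        (ENNReal.ofReal C⁻¹ * MetricCapacity.rieszCapacity μ β p (E ∩ Metric.closedBall x r) ≤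
            MetricCapacity.hajlaszCapacity μ β p (E ∩ Metric.closedBall x r)
              (Metric.ball x (2 * r)) ∧
          MetricCapacity.hajlaszCapacity μ β p (E ∩ Metric.closedBall x r)
              (Metric.ball x (2 * r)) ≤
            ENNReal.ofReal C * MetricCapacity.rieszCapacity μ β p (E ∩ Metric.closedBall x r)) ∧
        (ENNReal.ofReal C⁻¹ *
              MetricCapacity.rieszCapacityOfDim μ Q β p (E ∩ Metric.closedBall x r) ≤
            MetricCapacity.hajlaszCapacity μ β p (E ∩ Metric.closedBall x r)
              (Metric.ball x (2 * r)) ∧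
          MetricCapacity.hajlaszCapacity μ β p (E ∩ Metric.closedBall x r)
              (Metric.ball x (2 * r)) ≤
            ENNReal.ofReal C *
              MetricCapacity.rieszCapacityOfDim μ Q β p (E ∩ Metric.closedBall x r)) := by
  -- A one-point space has diameter 0, so no radius is admissible.
  rcases subsingleton_or_nontrivial X with hX | hX
  · refine ⟨1, one_pos, fun E x r _ _ _ h => absurd h ?_⟩
    rw [Metric.ediam_subsingleton Set.subsingleton_univ, ENNReal.zero_div]
    exact not_lt_zero
  have hp0 : 0 < p := by linarith
  have hβQ : β < Q := by nlinarith
  have hfin : ∀ (x : X) (r : ℝ), 0 < r → μ (Metric.ball x r) < ∞ := fun x r hr => (hμ x r hr).2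
  obtain ⟨c, hc1, hup⟩ := hreg.exists_measure_ball_le hQ0 hfin
  obtain ⟨c₀, hc₀, hboth⟩ := hreg
  have hc : 0 < c := by linarith
  have hb : 0 < c₀⁻¹ := inv_pos.2 (by linarith)
  have hlow : ∀ (x : X) (t : ℝ), 0 < t → ENNReal.ofReal t < Metric.ediam (Set.univ : Set X) →
      ENNReal.ofReal (c₀⁻¹ * t ^ Q) ≤ μ (Metric.ball x t) := fun x t ht h => (hboth x t ht h).1
  have hμ0 := MetricCapacity.measure_singleton_of_measure_ball_le hQ0 hup
  have hproper : ProperSpace X := by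
    refine MetricCapacity.properSpace_of_le_measure_ball hfin fun ε hε => ?_
    obtain ⟨x₀, x₁, hne⟩ := exists_pair_ne X
    have hd : 0 < dist x₀ x₁ := dist_pos.2 hne
    refine ⟨min ε (dist x₀ x₁ / 2), lt_min hε (half_pos hd), min_le_left _ _,
      ENNReal.ofReal (c₀⁻¹ * min ε (dist x₀ x₁ / 2) ^ Q), ?_, fun x => hlow x _ ?_ ?_⟩
    · have : 0 < min ε (dist x₀ x₁ / 2) := lt_min hε (half_pos hd)
      exact ENNReal.ofReal_pos.2 (by positivity)
    · exact lt_min hε (half_pos hd)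
    · refine ((ENNReal.ofReal_lt_ofReal_iff hd).2
        ((min_le_right _ _).trans_lt (half_lt_self hd))).trans_le ?_
      rw [← edist_dist]
      exact Metric.edist_le_ediam_of_mem (Set.mem_univ _) (Set.mem_univ _)
  obtain ⟨A, hA, hRH⟩ := MetricCapacity.exists_rieszCapacityOfDim_le_hajlaszCapacity
    hβ0 hβQ hp0 hb hμ0 hfin hlow
  obtain ⟨B, hB, hHR⟩ := MetricCapacity.exists_hajlaszCapacity_le_rieszCapacityOfDim
    hc hβ0 hβ1 hp hQ hμ0 hup
  set D₁ : ℝ := (2 ^ Q / c₀⁻¹) ^ p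
  set D₂ : ℝ := c ^ p
  have hD₁ : 0 < D₁ := by positivity
  have hD₂ : 0 < D₂ := by positivity
  have hDA : 0 < D₂ * A := by positivity
  have hBD : 0 < B * D₁ := by positivity
  -- The sum dominates the four one-sided constants: `A`, `B` for the kernel `d ^ (β - Q)`, and `D₂
  -- * A`, `B * D₁` after passing to the other kernel.
  refine ⟨A + B + D₂ * A + B * D₁, by positivity, fun E x r hE hx hr hr8 => ?_⟩
  have hr8' : ENNReal.ofReal (8 * r) < Metric.ediam (Set.univ : Set X) := by
    rw [ENNReal.lt_div_iff_mul_lt (by norm_num) (by norm_num)] at hr8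
    rwa [mul_comm, ENNReal.ofReal_mul hr.le, ENNReal.ofReal_ofNat]
  set F := E ∩ Metric.closedBall x r
  have hF : F ⊆ Metric.closedBall x r := Set.inter_subset_right
  have hFc : IsCompact F := (isCompact_closedBall x r).inter_left hE
  have h1 := hRH F x r hr hr8' hF
  have h2 := hHR F x r hr hFc hF
  have h3 := MetricCapacity.rieszCapacityOfDim_le_rieszCapacity (β := β) hb hp0.le hμ0 hlow F
  have h4 := MetricCapacity.rieszCapacity_le_rieszCapacityOfDim (β := β) hc hp0.le hμ0 hup F
  refine ⟨ENNReal.ofReal_inv_mul_le_and_le (A := D₂ * A) (B := B * D₁) (by positivity)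
      (by linarith) (by linarith) ?_ ?_,
    ENNReal.ofReal_inv_mul_le_and_le (by positivity) (by linarith) (by linarith) h1 h2⟩
  · refine h4.trans ?_
    rw [ENNReal.ofReal_mul hD₂.le, mul_assoc]
    gcongr
  · refine h2.trans ?_
    rw [ENNReal.ofReal_mul hB.le, mul_assoc]
    gcongr
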